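/- Let $k\ge 1$ and let $p_1,\dots,p_k,q_1,\dots,q_k\ge 0$ satisfy $\sum_{j=1}^k(p_j+q_j)=1$, $\sum_{j=1}^k p_j>0$, $\sum_{j=1}^k q_j>0$ and $\gcd\{j:p_j+q_j>0\}=1$. Put $k_p=\max\{j:p_j>0\}$, $k_q=\max\{j:q_j>0\}$ and $\mu=\sum_{j=1}^k j(p_j-q_j)$. The simple random leap is the Markov chain on $\mathbb Z$ that, from any state $i$, moves to $i+j$ with probability $p_j$ and to $i-j$ with probability $q_j$ ($1\le j\le k$). The one-sided reflecting random leap is the Markov chain on $\{0,1,2,\dots\}$ whose transition probability from $i$ to $j\ge 1$ is that of the simple random leap, and whose transition probability from $i$ to $0$ is the probability that the simple random leap moves from $i$ to a state $\le 0$. Let $\psi(z)=\sum_{j=0}^{2k-1}\gamma_j z^j$, where $\gamma_j=-\sum_{\ell=k-j}^{k}p_\ell$ for $0\le j\le k-1$ and $\gamma_j=\sum_{\ell=j-k+1}^{k}q_\ell$ for $k\le j\le 2k-1$. Let $y_1,\dots,y_s$ be the distinct nonzero complex roots of $\psi$, listed in ascending order of absolute value (ties broken arbitrarily), with multiplicities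 $r_1,\dots,r_s$. For each $j$ consider the $r_j$ columns (indexed by $1\le \ell\le r_j$), with infinitely many rows (indexed by $i\ge 1$), with entries $(i+1-k_p)^{\ell-1}y_j^{\,i+1-k_p}$ (where $0^0=1$). Put these blocks of columns side by side for $j=1,\dots,s$, and let $\Psi$ consist of the first $k_p$ of all these columns. For $i\ge 0$ let $H_i$ be the half-accordion matrix with $k_p$ rows and infinitely many columns $$H_i=\begin{pmatrix} I_{k_p-1}&0&0&\cdots\\ 0&\mathbf 1_i^{T}&0&\cdots\end{pmatrix},$$ where $\mathbf 1_i$ is the vector of $i$ ones. Let $\eta_\infty$ be the infinite vector with entries $\eta_j=\sum_{\ell=j-k_p+1}^{k_q}(\ell-j+k_p)q_\ell$ for $k_p\le j\le k_p+k_q-1$ and $\eta_j=0$ otherwise. Define the $(k_p+1)\times(k_p+1)$ matrix $$\Omega_i=\begin{pmatrix}H_i\Psi& e_{k_p-1}-e_{k_p}\\ \eta_\infty^{T}\Psi&\sum_{\ell=1}^{k_p}p_\ell-\sum_{\ell=1}^{k_q}\ell q_\ell\end{pmatrix},$$ where $e_{k_p-1},e_{k_p}$ are unit vectors of length $k_p$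 and $e_{k_p-1}=0$ if $k_p=1$. Then: 1. If $\mu\ge 0$, the one-sided reflecting random leap has no stationary distribution. 2. If $\mu<0$, the one-sided reflecting random leap has exactly one stationary distribution $\pi=(\pi_0,\pi_1,\dots)$. For every listing of the roots as above, exactly $k_p$ nonzero roots of $\psi$ (counted with multiplicity) have absolute value less than $1$, so that $\Psi$ is built from exactly these roots; the series $\sum_{j=0}^\infty\det(\Omega_j)$ converges absolutely to a nonzero number; and $$\pi_i=\frac{\det(\Omega_i)}{\sum_{j=0}^\infty\det(\Omega_j)}\qquad\text{for every } i\in\{0,1,2,\dots\}.$$ -/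

import Mathlib

/-- The parameters of a random leap: a maximal step size `k ≥ 1` and nonnegative numbers
`p₁, …, p_k` (upward steps) and `q₁, …, q_k` (downward steps) with `∑ (p_j + q_j) = 1`.
The sequences are extended by zero outside `{1, …, k}`.  The last two fields are the standing
assumption that steps in both directions have positive probability. -/
structure RandomLeap where
  k : ℕ
  p : ℕ → ℝ
  q : ℕ → ℝ
  one_le_k : 1 ≤ k
  p_nonneg : ∀ j, 0 ≤ p j
  q_nonneg : ∀ j, 0 ≤ q j
  p_support : ∀ j, j ∉ Finset.Icc 1 k → p j = 0
  q_support : ∀ j, j ∉ Finset.Icc 1 k → q j = 0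
  sum_eq_one : ∑ j ∈ Finset.Icc 1 k, (p j + q j) = 1
  sum_p_pos : 0 < ∑ j ∈ Finset.Icc 1 k, p j
  sum_q_pos : 0 < ∑ j ∈ Finset.Icc 1 k, q j

/-- A stationary distribution of a Markov chain on `ℕ` with transition matrix `P`: a probability
vector `π` with `π P = π`. -/
def IsStationaryDistribution (P : ℕ → ℕ → ℝ) (π : ℕ → ℝ) : Prop :=
  (∀ i, 0 ≤ π i) ∧ HasSum π 1 ∧ ∀ j, HasSum (fun i => π i * P i j) (π j)

namespace RandomLeap

open Polynomial

noncomputable section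

/-- The transition probabilities of the simple random leap on `ℤ`. -/
def simpleTransition (L : RandomLeap) (i j : ℤ) : ℝ :=
  if i + 1 ≤ j ∧ j ≤ i + L.k then L.p (j - i).toNat
  else if i - L.k ≤ j ∧ j ≤ i - 1 then L.q (i - j).toNat
  else 0

/-- The transition probabilities of the one-sided reflecting random leap on `{0, 1, …}`: all the
mass that the simple random leap sends to `{…, -1, 0}` is sent to `0`. -/
def reflectTransition (L : RandomLeap) (i j : ℕ) : ℝ :=
  if j = 0 then ∑' m : Set.Iic (0 : ℤ), L.simpleTransition i m
  else L.simpleTransition i j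

/-- The drift `μ = ∑ j (p_j - q_j)`. -/
def drift (L : RandomLeap) : ℝ := ∑ j ∈ Finset.Icc 1 L.k, (j : ℝ) * (L.p j - L.q j)

/-- `k_p = max {j : p_j > 0}`. -/
def kp (L : RandomLeap) : ℕ := ((Finset.Icc 1 L.k).filter fun j => 0 < L.p j).sup id

/-- `k_q = max {j : q_j > 0}`. -/
def kq (L : RandomLeap) : ℕ := ((Finset.Icc 1 L.k).filter fun j => 0 < L.q j).sup id

/-- The coefficients `γ_j` of the reverse characteristic polynomial. -/
def gammaCoeff (L : RandomLeap) (j : ℕ) : ℝ :=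
  if j < L.k then -∑ l ∈ Finset.Icc (L.k - j) L.k, L.p l
  else ∑ l ∈ Finset.Icc (j - L.k + 1) L.k, L.q l

/-- The reverse characteristic polynomial `ψ(z) = ∑_{j=0}^{2k-1} γ_j z^j`. -/
def psi (L : RandomLeap) : ℂ[X] :=
  ∑ j ∈ Finset.range (2 * L.k), C (L.gammaCoeff j : ℂ) * X ^ j

/-- A list `y_1, …, y_s` of the distinct nonzero roots of `ψ`, in ascending order of absolute
value, with ties broken arbitrarily. -/
structure RootOrdering (L : RandomLeap) where
  s : ℕ
  y : Fin s → ℂ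
  injective : Function.Injective y
  range_eq : Set.range y = {z : ℂ | z ≠ 0 ∧ L.psi.IsRoot z}
  mono : Monotone fun j => ‖y j‖

/-- The multiplicity `r_j` of the root `y_j` of `ψ`. -/
def RootOrdering.mult {L : RandomLeap} (R : L.RootOrdering) (j : Fin R.s) : ℕ :=
  L.psi.rootMultiplicity (R.y j)

theorem kp_mem (L : RandomLeap) : L.kp ∈ Finset.Icc 1 L.k ∧ 0 < L.p L.kp := by
  have hne : ((Finset.Icc 1 L.k).filter fun j => 0 < L.p j).Nonempty := by
    obtain ⟨j, hj, h⟩ := Finset.exists_lt_of_sum_lt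
      (s := Finset.Icc 1 L.k) (f := fun _ => (0 : ℝ)) (g := L.p) (by simpa using L.sum_p_pos)
    exact ⟨j, Finset.mem_filter.2 ⟨hj, h⟩⟩
  obtain ⟨j, hj, h⟩ := Finset.exists_mem_eq_sup _ hne id
  have : L.kp = j := h
  rw [this]
  exact Finset.mem_filter.1 hj

theorem kq_mem (L : RandomLeap) : L.kq ∈ Finset.Icc 1 L.k ∧ 0 < L.q L.kq := by
  have hne : ((Finset.Icc 1 L.k).filter fun j => 0 < L.q j).Nonempty := by
    obtain ⟨j, hj, h⟩ := Finset.exists_lt_of_sum_lt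
      (s := Finset.Icc 1 L.k) (f := fun _ => (0 : ℝ)) (g := L.q) (by simpa using L.sum_q_pos)
    exact ⟨j, Finset.mem_filter.2 ⟨hj, h⟩⟩
  obtain ⟨j, hj, h⟩ := Finset.exists_mem_eq_sup _ hne id
  have : L.kq = j := h
  rw [this]
  exact Finset.mem_filter.1 hj

theorem psi_coeff (L : RandomLeap) (j : ℕ) (hj : j < 2 * L.k) :
    L.psi.coeff j = (L.gammaCoeff j : ℂ) := by
  simp [psi, coeff_X_pow, hj]

theorem psi_coeff_low_ne (L : RandomLeap) : L.psi.coeff (L.k - L.kp) ≠ 0 := by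
  obtain ⟨h, hp⟩ := L.kp_mem
  rw [Finset.mem_Icc] at h
  rw [psi_coeff _ _ (by omega)]
  have : 0 < ∑ l ∈ Finset.Icc L.kp L.k, L.p l :=
    lt_of_lt_of_le hp (Finset.single_le_sum (f := L.p) (fun i _ => L.p_nonneg i)
      (Finset.mem_Icc.2 ⟨le_rfl, h.2⟩))
  have e : L.k - (L.k - L.kp) = L.kp := by omega
  rw [gammaCoeff, if_pos (by omega), e]
  exact_mod_cast (neg_ne_zero.2 this.ne')

theorem psi_coeff_high_ne (L : RandomLeap) : L.psi.coeff (L.k + L.kq - 1) ≠ 0 := by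
  obtain ⟨h, hq⟩ := L.kq_mem
  rw [Finset.mem_Icc] at h
  rw [psi_coeff _ _ (by omega)]
  have : 0 < ∑ l ∈ Finset.Icc L.kq L.k, L.q l :=
    lt_of_lt_of_le hq (Finset.single_le_sum (f := L.q) (fun i _ => L.q_nonneg i)
      (Finset.mem_Icc.2 ⟨le_rfl, h.2⟩))
  have e : L.k + L.kq - 1 - L.k + 1 = L.kq := by omega
  rw [gammaCoeff, if_neg (by omega), e]
  exact_mod_cast this.ne'

theorem psi_ne_zero (L : RandomLeap) : L.psi ≠ 0 := fun h => L.psi_coeff_low_ne (by simp [h])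

/-- The nonzero roots can be listed as required. -/
theorem nonempty_rootOrdering (L : RandomLeap) : Nonempty L.RootOrdering := by
  classical
  let S : Finset ℂ := L.psi.roots.toFinset.erase 0
  let f : Fin S.card → ℂ := fun i => (S.equivFin.symm i : ℂ)
  have hf : Function.Injective f := Subtype.val_injective.comp S.equivFin.symm.injective
  let σ := Tuple.sort fun i => ‖f i‖
  refine ⟨⟨S.card, f ∘ σ, hf.comp σ.injective, ?_, Tuple.monotone_sort fun i => ‖f i‖⟩⟩
  rw [σ.surjective.range_comp]
  ext z
  have h1 : z ∈ Set.range f ↔ z ∈ S := by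
    constructor
    · rintro ⟨i, rfl⟩
      exact (S.equivFin.symm i).2
    · intro hz
      exact ⟨S.equivFin ⟨z, hz⟩, by simp [f]⟩
  rw [h1]
  simp [S, L.psi_ne_zero]

/-- The nonzero roots of `ψ`, counted with multiplicity, are at least `k_p` in number, so that the
matrix of all their columns does have a first `k_p` columns. -/
theorem RootOrdering.kp_le_sum_mult {L : RandomLeap} (R : L.RootOrdering) :
    L.kp ≤ ∑ j, R.mult j := by
  classical
  have hp := Finset.mem_Icc.1 L.kp_mem.1
  have hq := Finset.mem_Icc.1 L.kq_mem.1
  have hdeg : L.k + L.kq - 1 ≤ L.psi.natDegree := le_natDegree_of_ne_zero L.psi_coeff_high_ne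
  have hmul : L.psi.rootMultiplicity 0 ≤ L.k - L.kp := by
    rw [rootMultiplicity_eq_natTrailingDegree']
    exact natTrailingDegree_le_of_ne_zero L.psi_coeff_low_ne
  have hcard : L.psi.roots.card = L.psi.natDegree :=
    (IsAlgClosed.splits L.psi).natDegree_eq_card_roots.symm
  have himg : Finset.univ.image R.y = L.psi.roots.toFinset.erase 0 := by
    ext z
    have := Set.ext_iff.1 R.range_eq z
    simp only [Set.mem_range, Set.mem_ofPred_eq] at this
    simp [this, L.psi_ne_zero]
  have hsum : ∑ j, R.mult j = ∑ z ∈ L.psi.roots.toFinset.erase 0, L.psi.roots.count z := by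
    rw [← himg, Finset.sum_image (fun a _ b _ h => R.injective h)]
    simp [RootOrdering.mult]
  have htot : L.psi.rootMultiplicity 0 + ∑ j, R.mult j = L.psi.natDegree := by
    rw [hsum, ← hcard, ← Multiset.toFinset_sum_count_eq, ← count_roots]
    by_cases h0 : (0 : ℂ) ∈ L.psi.roots.toFinset
    · exact Finset.add_sum_erase _ (fun z => L.psi.roots.count z) h0
    · rw [Finset.erase_eq_of_notMem h0, Multiset.count_eq_zero_of_notMem (by simpa using h0),
        zero_add]
  omega

/-- The column `c` of `Ψ` (`c` counts from `0`) lies in the block of the root `y_j`, at position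
`l` of that block (`l` counts from `0`), where `⟨j, l⟩ = R.column c`: the blocks of sizes
`r_1, …, r_s` are put side by side in this order and the first `k_p` columns are kept. -/
def RootOrdering.column {L : RandomLeap} (R : L.RootOrdering) (c : Fin L.kp) :
    (j : Fin R.s) × Fin (R.mult j) :=
  finSigmaFinEquiv.symm (Fin.castLE R.kp_le_sum_mult c)

/-- The matrix `Ψ`, with infinitely many rows and `k_p` columns.  Rows count from `0`, so that
row `m` here is the row `i = m + 1` with entries `(i + 1 - k_p)^l * y_j^(i + 1 - k_p)`, where `l`
counts from `0`. -/
def RootOrdering.Psi {L : RandomLeap} (R : L.RootOrdering) : Matrix ℕ (Fin L.kp) ℂ :=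
  Matrix.of fun m c =>
    (((m : ℂ) + 2 - (L.kp : ℂ)) ^ ((R.column c).2 : ℕ)) *
      R.y (R.column c).1 ^ ((m : ℤ) + 2 - (L.kp : ℤ))

/-- The half-accordion matrix `H_i`, with `k_p` rows and infinitely many columns (both counted
from `0`): an identity block of size `k_p - 1`, and a last row with `k_p - 1` zeros followed by
`i` ones and zeros. -/
def halfAccordion (L : RandomLeap) (i : ℕ) : Matrix (Fin L.kp) ℕ ℂ :=
  Matrix.of fun a m =>
    if (a : ℕ) + 1 < L.kp then (if m = (a : ℕ) then 1 else 0)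
    else (if L.kp - 1 ≤ m ∧ m < L.kp - 1 + i then 1 else 0)

/-- The vector `η_∞` (entries counted from `0`, so that entry `m` here is the entry
`j = m + 1`): `η_j = ∑_{l=j-k_p+1}^{k_q} (l - j + k_p) q_l` for `k_p ≤ j ≤ k_p + k_q - 1`, and
`0` otherwise. -/
def eta (L : RandomLeap) (m : ℕ) : ℝ :=
  if L.kp ≤ m + 1 ∧ m + 1 ≤ L.kp + L.kq - 1 then
    ∑ l ∈ Finset.Icc (m + 1 - L.kp + 1) L.kq, ((l : ℝ) - ((m : ℝ) + 1) + (L.kp : ℝ)) * L.q l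
  else 0

/-- The `(k_p + 1) × (k_p + 1)` matrix `Ω_i`, in block form.  The products with `Ψ` are sums over
its infinitely many rows with only finitely many nonzero terms. The unit vector `e_{k_p - 1}` is
zero if `k_p = 1`. -/
def RootOrdering.Omega {L : RandomLeap} (R : L.RootOrdering) (i : ℕ) :
    Matrix (Fin L.kp ⊕ Unit) (Fin L.kp ⊕ Unit) ℂ :=
  Matrix.fromBlocks
    (Matrix.of fun a c => ∑' m : ℕ, L.halfAccordion i a m * R.Psi m c)
    (Matrix.of fun a _ =>
      (if (a : ℕ) + 2 = L.kp then 1 else 0) - (if (a : ℕ) + 1 = L.kp then 1 else 0))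
    (Matrix.of fun _ c => ∑' m : ℕ, (L.eta m : ℂ) * R.Psi m c)
    (Matrix.of fun _ _ =>
      (((∑ l ∈ Finset.Icc 1 L.kp, L.p l) - ∑ l ∈ Finset.Icc 1 L.kq, (l : ℝ) * L.q l : ℝ) : ℂ))

end

end RandomLeap

/-! Extend a measure on `{0, 1, …}` by zero to `ℤ`. Stationarity at the states `j ≥ 1` says that it
is harmonic there (`step` fixes it), hence that its net flow `flux` is constant on `ℕ`. For a
solution tending to zero the flow vanishes, and this replaces the equation at state `0`. By a
minimum principle such a solution is determined on its domain by its values at `1 - kp, …, 0`; the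
stationary one has boundary data `0, …, 0, 1` up to scale. Summing the zero flow over all cuts
forces `drift < 0` (`drift_neg_of_summable`).

For existence, `ψ` is, up to sign and a shift of position, the symbol of `flux`, so its roots give
harmonic exponential polynomials. Those with roots inside the unit disc are summable at `+∞`, and
the minimum principle allows at most `kp` of them. Reflection turns the roots outside the disc into
decaying solutions for the leap of opposite drift, which allows at most `kq - 1`. There are at least
`kp + kq - 1` nonzero roots, and none on the unit circle by the gcd condition, so both bounds are
attained (`sum_mult_norm_lt_one`) and all boundary data are realized.

If `f` is the solution with data `0, …, 0, 1`, expand its increments in the columns of `Ψ` with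
coefficients `v`. Then `Ω_i` maps `(v, -1)` to `f i` times a unit vector. Cramer's rule gives `det
Ω_i = -K * f i` with `K` a minor independent of `i`, nonzero because `drift ≠ 0`; normalization
removes `K`. -/

namespace RandomLeap

open Filter Topology Polynomial

noncomputable section

/-! ### Harmonic sequences and net flow -/

section Step

variable {V : Type*} [AddCommGroup V] [Module ℝ V]

/-- The transfer operator of the simple random leap, acting on measures on `ℤ`. -/
def step (L : RandomLeap) (f : ℤ → V) (j : ℤ) : V :=
  ∑ l ∈ Finset.Icc 1 L.k, (L.p l • f (j - l) + L.q l • f (j + l))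

/-- The net flow from `{…, j}` to `{j + 1, …}` under the measure `f`. -/
def flux (L : RandomLeap) (f : ℤ → V) (j : ℤ) : V :=
  ∑ l ∈ Finset.Icc 1 L.k,
    (L.p l • ∑ t ∈ Finset.range l, f (j - t) - L.q l • ∑ t ∈ Finset.range l, f (j + 1 + t))

theorem map_step {V' : Type*} [AddCommGroup V'] [Module ℝ V'] (L : RandomLeap) (φ : V →ₗ[ℝ] V')
    (f : ℤ → V) (j : ℤ) : φ (L.step f j) = L.step (fun i => φ (f i)) j := by
  simp [step]

/-- A discrete continuity equation: moving the cut by one makes both window sums telescope to their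
endpoints. -/
theorem flux_sub_flux (L : RandomLeap) (f : ℤ → V) (j : ℤ) :
    L.flux f (j + 1) - L.flux f j = f (j + 1) - L.step f (j + 1) := by
  have h1 : f (j + 1) = ∑ l ∈ Finset.Icc 1 L.k, (L.p l + L.q l) • f (j + 1) := by
    rw [← Finset.sum_smul, L.sum_eq_one, one_smul]
  have hp (l : ℕ) : ∑ t ∈ Finset.range l, f (j + 1 - t) - ∑ t ∈ Finset.range l, f (j - t)
      = f (j + 1) - f (j + 1 - l) := by
    have := Finset.sum_range_sub' (fun t : ℕ => f (j + 1 - t)) l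
    rw [← Finset.sum_sub_distrib]
    simp only [Nat.cast_add, Nat.cast_one, Nat.cast_zero, sub_zero] at this
    rw [← this]
    refine Finset.sum_congr rfl fun t _ => ?_
    congr 2
    ring
  have hq (l : ℕ) : ∑ t ∈ Finset.range l, f (j + 1 + 1 + t) - ∑ t ∈ Finset.range l, f (j + 1 + t)
      = f (j + 1 + l) - f (j + 1) := by
    have := Finset.sum_range_sub (fun t : ℕ => f (j + 1 + t)) l
    rw [← Finset.sum_sub_distrib]
    simp only [Nat.cast_add, Nat.cast_one, Nat.cast_zero, add_zero] at this
    rw [← this]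
    refine Finset.sum_congr rfl fun t _ => ?_
    congr 2
    ring
  conv_rhs => rw [h1, step, ← Finset.sum_sub_distrib]
  rw [flux, flux, ← Finset.sum_sub_distrib]
  refine Finset.sum_congr rfl fun l _ => ?_
  have e : ∀ a b c d : V, L.p l • a - L.q l • b - (L.p l • c - L.q l • d)
      = L.p l • (a - c) - L.q l • (b - d) := fun a b c d => by module
  rw [e, hp, hq]
  module

theorem flux_eq_flux_zero (L : RandomLeap) (f : ℤ → V)
    (hf : ∀ j, 1 ≤ j → L.step f j = f j) (n : ℕ) : L.flux f n = L.flux f 0 := by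
  induction n with
  | zero => rfl
  | succ n ih =>
    have := L.flux_sub_flux f n
    rw [hf _ (by omega), sub_self, sub_eq_zero] at this
    rw [← ih, ← this]
    norm_cast

/-- The flow across the cut at `n` is a fixed finite combination of values of `f` near `n`, so it
tends to zero; but it is constant in `n`. -/
theorem flux_zero_eq_zero [TopologicalSpace V] [T2Space V] [IsTopologicalAddGroup V]
    [ContinuousConstSMul ℝ V] (L : RandomLeap) (f : ℤ → V)
    (hf : ∀ j, 1 ≤ j → L.step f j = f j) (h0 : Tendsto (fun n : ℕ => f n) atTop (𝓝 0)) :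
    L.flux f 0 = 0 := by
  have hs (t : ℕ) : Tendsto (fun n : ℕ => f (n - t)) atTop (𝓝 0) := by
    rw [← tendsto_add_atTop_iff_nat t]
    simpa using h0
  have ha (t : ℕ) : Tendsto (fun n : ℕ => f (n + 1 + t)) atTop (𝓝 0) := by
    have := (tendsto_add_atTop_iff_nat (1 + t)).2 h0
    simpa [add_assoc] using this
  have : Tendsto (fun n : ℕ => L.flux f n) atTop (𝓝 0) := by
    have : Tendsto (fun n : ℕ => L.flux f n) atTop
        (𝓝 (∑ l ∈ Finset.Icc 1 L.k, (L.p l • ∑ t ∈ Finset.range l, (0 : V)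
          - L.q l • ∑ t ∈ Finset.range l, (0 : V)))) :=
      tendsto_finsetSum _ fun l _ =>
        ((tendsto_finsetSum _ fun t _ => hs t).const_smul _).sub
          ((tendsto_finsetSum _ fun t _ => ha t).const_smul _)
    simpa using this
  refine tendsto_nhds_unique ?_ this
  simp only [L.flux_eq_flux_zero f hf]
  exact tendsto_const_nhds

theorem p_eq_zero_of_kp_lt (L : RandomLeap) {l : ℕ} (h : L.kp < l) : L.p l = 0 := by
  by_contra hne
  have hl : l ∈ Finset.Icc 1 L.k := by
    by_contra hl
    exact hne (L.p_support l hl)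
  have : id l ≤ L.kp := Finset.le_sup
    (Finset.mem_filter.2 ⟨hl, lt_of_le_of_ne (L.p_nonneg l) (Ne.symm hne)⟩)
  simp only [id] at this
  omega

theorem q_eq_zero_of_kq_lt (L : RandomLeap) {l : ℕ} (h : L.kq < l) : L.q l = 0 := by
  by_contra hne
  have hl : l ∈ Finset.Icc 1 L.k := by
    by_contra hl
    exact hne (L.q_support l hl)
  have : id l ≤ L.kq := Finset.le_sup
    (Finset.mem_filter.2 ⟨hl, lt_of_le_of_ne (L.q_nonneg l) (Ne.symm hne)⟩)
  simp only [id] at this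
  omega

/-- A harmonic function on `ℤ` that vanishes on a half-line vanishes everywhere. -/
theorem eq_zero_of_forall_nonneg (L : RandomLeap) (f : ℤ → V) (hf : ∀ j, L.step f j = f j)
    (h0 : ∀ i, 0 ≤ i → f i = 0) : f = 0 := by
  have hp := L.kp_mem
  have hp1 := Finset.mem_Icc.1 hp.1
  have key : ∀ n : ℕ, ∀ i : ℤ, -n ≤ i → f i = 0 := by
    intro n
    induction n with
    | zero => simpa using h0
    | succ n ih =>
      intro i hi
      rcases (by omega : -(n : ℤ) ≤ i ∨ i = -n - 1) with h | rfl
      · exact ih i h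
      -- The equation `kp` sites above the next unknown involves that unknown alone, with
      -- coefficient `p kp > 0`.
      have hj := hf (-n - 1 + L.kp)
      rw [ih _ (by omega), step, Finset.sum_eq_single_of_mem L.kp hp.1] at hj
      · rw [ih (-n - 1 + L.kp + L.kp) (by omega), add_sub_cancel_right, smul_zero, add_zero] at hj
        exact (smul_eq_zero.1 hj).resolve_left hp.2.ne'
      · intro l hl hne
        have hl1 := Finset.mem_Icc.1 hl
        rw [ih (-n - 1 + L.kp + l) (by omega), smul_zero, add_zero]
        rcases lt_or_gt_of_ne hne with h | h
        · rw [ih _ (by omega), smul_zero]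
        · rw [L.p_eq_zero_of_kp_lt h, zero_smul]
  funext i
  exact key i.natAbs i (by omega)

end Step

/-! ### Minimum principle and the sign of the drift -/

/-- Minimum principle on the half-line. -/
theorem nonneg_of_boundary_nonneg (L : RandomLeap) (f : ℤ → ℝ)
    (hf : ∀ j, 1 ≤ j → L.step f j = f j)
    (hb : ∀ i, 1 - (L.kp : ℤ) ≤ i → i ≤ 0 → 0 ≤ f i)
    (h0 : Tendsto (fun n : ℕ => f n) atTop (𝓝 0)) (i : ℤ) (hi : 1 - (L.kp : ℤ) ≤ i) :
    0 ≤ f i := by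
  by_contra! hneg
  have hi1 : 1 ≤ i := by
    by_contra! h
    exact absurd (hb i hi (by omega)) (not_le.2 hneg)
  obtain ⟨N, hN⟩ := eventually_atTop.1 (h0.eventually (lt_mem_nhds hneg))
  -- Beyond `N` the values exceed `f i`, so a negative infimum is attained on this finite window.
  obtain ⟨j₀, hj₀, hmin⟩ := Finset.exists_min_image (Finset.Icc (1 : ℤ) (max i N)) f
    ⟨i, Finset.mem_Icc.2 ⟨hi1, le_max_left _ _⟩⟩
  have hm : f j₀ ≤ f i := hmin i (Finset.mem_Icc.2 ⟨hi1, le_max_left _ _⟩)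
  have hglob : ∀ j, 1 - (L.kp : ℤ) ≤ j → f j₀ ≤ f j := by
    intro j hj
    rcases lt_or_ge j 1 with h | h
    · exact (hm.trans hneg.le).trans (hb j hj (by omega))
    rcases le_or_gt j (max i N) with h' | h'
    · exact hmin j (Finset.mem_Icc.2 ⟨h, h'⟩)
    · have : (N : ℤ) < j := (le_max_right _ _).trans_lt h'
      have h2 := hN j.toNat (by omega)
      rw [Int.toNat_of_nonneg (by omega)] at h2
      exact hm.trans h2.le
  have hex : ∃ n : ℕ, f (n + 1) = f j₀ :=
    ⟨(j₀ - 1).toNat, by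
      have := (Finset.mem_Icc.1 hj₀).1
      rw [Int.toNat_of_nonneg (by omega)]
      congr 1
      ring⟩
  classical
  obtain ⟨n, hn, hlt⟩ : ∃ n : ℕ, f (n + 1) = f j₀ ∧ ∀ m < n, f (m + 1) ≠ f j₀ :=
    ⟨Nat.find hex, Nat.find_spec hex, fun m hm => Nat.find_min hex hm⟩
  have hp := L.kp_mem
  have hp1 := Finset.mem_Icc.1 hp.1
  -- As `n + 1` is the first positive minimizer, the site `kp` below it is a boundary site or an
  -- earlier one; either way its value is strictly larger, and averaging at `n + 1` fails.
  have hstrict : f j₀ < f (n + 1 - L.kp) := by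
    rcases lt_or_ge (n : ℤ) L.kp with h | h
    · exact (hm.trans_lt hneg).trans_le (hb _ (by omega) (by omega))
    · refine lt_of_le_of_ne (hglob _ (by omega)) fun he => hlt (n - L.kp) (by omega) ?_
      rw [he]
      congr 1
      push_cast [Nat.cast_sub (by omega : L.kp ≤ n)]
      ring
  have hsum : ∑ l ∈ Finset.Icc 1 L.k, (L.p l + L.q l) * f j₀ < L.step f (n + 1) := by
    refine Finset.sum_lt_sum (fun l hl => ?_) ⟨L.kp, hp.1, ?_⟩
    · have hl1 := Finset.mem_Icc.1 hl
      simp only [smul_eq_mul]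
      rw [add_mul]
      refine add_le_add ?_ (mul_le_mul_of_nonneg_left (hglob _ (by omega)) (L.q_nonneg l))
      rcases le_or_gt l L.kp with h | h
      · exact mul_le_mul_of_nonneg_left (hglob _ (by omega)) (L.p_nonneg l)
      · simp [L.p_eq_zero_of_kp_lt h]
    · simp only [smul_eq_mul]
      rw [add_mul]
      exact add_lt_add_of_lt_of_le (mul_lt_mul_of_pos_left hstrict hp.2)
        (mul_le_mul_of_nonneg_left (hglob _ (by omega)) (L.q_nonneg _))
  rw [← Finset.sum_mul, L.sum_eq_one, one_mul, hf _ (by omega), hn] at hsum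
  exact lt_irrefl _ hsum

theorem step_neg (L : RandomLeap) (f : ℤ → ℝ) (j : ℤ) :
    L.step (fun i => -f i) j = -L.step f j := by
  simp only [step, smul_neg, ← Finset.sum_neg_distrib, neg_add]

theorem eq_zero_of_boundary_eq_zero (L : RandomLeap) (f : ℤ → ℝ)
    (hf : ∀ j, 1 ≤ j → L.step f j = f j)
    (hb : ∀ i, 1 - (L.kp : ℤ) ≤ i → i ≤ 0 → f i = 0)
    (h0 : Tendsto (fun n : ℕ => f n) atTop (𝓝 0)) (i : ℤ) (hi : 1 - (L.kp : ℤ) ≤ i) :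
    f i = 0 := by
  refine le_antisymm ?_ (L.nonneg_of_boundary_nonneg f hf (fun i h h' => (hb i h h').ge) h0 i hi)
  refine neg_nonneg.1 (L.nonneg_of_boundary_nonneg (fun i => -f i) (fun j hj => ?_)
    (fun i h h' => by simp [hb i h h']) (by simpa using h0.neg) i hi)
  rw [step_neg, hf j hj]

/-- A nonnegative summable solution of the stationarity equations forces negative drift. -/
theorem drift_neg_of_summable (L : RandomLeap) (f : ℤ → ℝ)
    (hf : ∀ j, 1 ≤ j → L.step f j = f j)
    (hb : ∀ i, 1 - (L.kp : ℤ) ≤ i → i < 0 → f i = 0) (hpos : 0 < f 0)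
    (hs : Summable fun n : ℕ => f n) : L.drift < 0 := by
  have h0 := hs.tendsto_atTop_zero
  have hnn := L.nonneg_of_boundary_nonneg f hf (fun i h h' => by
    rcases eq_or_lt_of_le h' with rfl | h'
    · exact hpos.le
    · exact (hb i h h').ge) h0
  set A := ∑' n : ℕ, f n with hA
  have hApos : 0 < A := hs.tsum_pos (fun n => hnn n (by
    have := (Finset.mem_Icc.1 L.kp_mem.1).1
    omega)) 0 (by simpa using hpos)
  have hflux (n : ℕ) : L.flux f n = 0 := by
    rw [L.flux_eq_flux_zero f hf, L.flux_zero_eq_zero f hf h0]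
  have hkp := (Finset.mem_Icc.1 L.kp_mem.1).1
  -- Shifting down by less than `kp` only adds boundary zeros, while the upward shifts below lose an
  -- initial segment.
  have hdown (t : ℕ) (ht : t < L.kp) : HasSum (fun n : ℕ => f (n - t)) A := by
    rw [← hasSum_nat_add_iff' t]
    have : ∑ i ∈ Finset.range t, f (i - t) = 0 := Finset.sum_eq_zero fun i hi => by
      have := Finset.mem_range.1 hi
      exact hb _ (by omega) (by omega)
    rw [this, sub_zero]
    simpa using hs.hasSum
  have hup (t : ℕ) : HasSum (fun n : ℕ => f (n + 1 + t))
      (A - ∑ i ∈ Finset.range (t + 1), f i) := by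
    have := (hasSum_nat_add_iff' (t + 1)).2 hs.hasSum
    simpa [add_assoc, add_comm (1 : ℤ)] using this
  have hdownl (l : ℕ) : HasSum (fun n : ℕ => L.p l • ∑ t ∈ Finset.range l, f (n - t))
      (L.p l * (l * A)) := by
    rcases le_or_gt l L.kp with h | h
    · have := (hasSum_sum (s := Finset.range l) fun t ht =>
        hdown t ((Finset.mem_range.1 ht).trans_le h)).mul_left (L.p l)
      simpa using this
    · simp [L.p_eq_zero_of_kp_lt h]
  have hupl (l : ℕ) : HasSum (fun n : ℕ => L.q l • ∑ t ∈ Finset.range l, f (n + 1 + t))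
      (L.q l * ∑ t ∈ Finset.range l, (A - ∑ i ∈ Finset.range (t + 1), f i)) := by
    simpa using (hasSum_sum (s := Finset.range l) fun t _ => hup t).mul_left (L.q l)
  have htot := hasSum_sum (s := Finset.Icc 1 L.k) fun l _ => (hdownl l).sub (hupl l)
  have hzero := htot.unique (by
    simpa [flux] using (funext hflux ▸ hasSum_zero : HasSum (fun n : ℕ => L.flux f n) 0))
  -- Of each lost segment only the term `f 0` is kept, which suffices for `drift * A + f 0 * ∑ l q_l
  -- ≤ 0`.
  have hle : ∑ l ∈ Finset.Icc 1 L.k, (L.p l * (l * A) - L.q l * (l * (A - f 0))) ≤ 0 := by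
    rw [← hzero]
    refine Finset.sum_le_sum fun l _ => sub_le_sub_left
      (mul_le_mul_of_nonneg_left ?_ (L.q_nonneg l)) _
    rw [← nsmul_eq_mul]
    conv_rhs => rw [← Finset.card_range l]
    refine Finset.sum_le_card_nsmul _ _ _ fun t _ => sub_le_sub_left ?_ _
    refine Finset.single_le_sum (f := fun i : ℕ => f i) (fun i _ => hnn i (by omega))
      (Finset.mem_range.2 t.succ_pos)
  have hq : 0 < ∑ l ∈ Finset.Icc 1 L.k, L.q l * (l * f 0) := by
    refine Finset.sum_pos' (fun l _ => by have := L.q_nonneg l; positivity) ⟨L.kq, L.kq_mem.1, ?_⟩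
    have h1 := L.kq_mem.2
    have h2 : (0 : ℝ) < L.kq := by exact_mod_cast (Finset.mem_Icc.1 L.kq_mem.1).1
    positivity
  have : L.drift * A + ∑ l ∈ Finset.Icc 1 L.k, L.q l * (l * f 0) ≤ 0 := by
    refine le_trans (le_of_eq ?_) hle
    rw [drift, Finset.sum_mul, ← Finset.sum_add_distrib]
    exact Finset.sum_congr rfl fun l _ => by ring
  by_contra! hd
  have := mul_nonneg hd hApos.le
  linarith

/-! ### From the Markov chain to harmonic sequences -/

theorem simpleTransition_eq (L : RandomLeap) (i j : ℤ) :
    L.simpleTransition i j = ∑ l ∈ Finset.Icc 1 L.k,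
      ((if i = j - l then L.p l else 0) + if i = j + l then L.q l else 0) := by
  rw [Finset.sum_add_distrib, simpleTransition]
  have hz (g : ℕ → ℝ) (P : ℕ → Prop) [DecidablePred P] (h : ∀ l ∈ Finset.Icc 1 L.k, ¬ P l) :
      ∑ l ∈ Finset.Icc 1 L.k, (if P l then g l else 0) = 0 :=
    Finset.sum_eq_zero fun l hl => if_neg (h l hl)
  have ho (g : ℕ → ℝ) (P : ℕ → Prop) [DecidablePred P] (m : ℕ) (hm : m ∈ Finset.Icc 1 L.k)
      (h : ∀ l ∈ Finset.Icc 1 L.k, P l ↔ l = m) :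
      ∑ l ∈ Finset.Icc 1 L.k, (if P l then g l else 0) = g m := by
    rw [Finset.sum_eq_single_of_mem m hm fun l hl hne => if_neg fun hP => hne ((h l hl).1 hP),
      if_pos ((h m hm).2 rfl)]
  split_ifs with h1 h2
  · rw [ho L.p _ (j - i).toNat, hz, add_zero]
    · intro l hl
      have := Finset.mem_Icc.1 hl
      omega
    · rw [Finset.mem_Icc]
      omega
    · intro l hl
      omega
  · rw [ho L.q _ (i - j).toNat, hz, zero_add]
    · intro l hl
      have := Finset.mem_Icc.1 hl
      omega
    · rw [Finset.mem_Icc]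
      omega
    · intro l hl
      omega
  · rw [hz, hz, add_zero]
    all_goals
      intro l hl
      have := Finset.mem_Icc.1 hl
      omega

theorem reflectTransition_zero (L : RandomLeap) (i : ℕ) :
    L.reflectTransition i 0 = ∑ l ∈ Finset.Icc 1 L.k, if i ≤ l then L.q l else 0 := by
  rw [reflectTransition, if_pos rfl, tsum_subtype]
  have h : (Set.Iic (0 : ℤ)).indicator (L.simpleTransition i) = fun m : ℤ =>
      ∑ l ∈ Finset.Icc 1 L.k, if m = i - l then (if i ≤ l then L.q l else 0) else 0 := by
    funext m
    rw [Set.indicator_apply]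
    split_ifs with hm
    · rw [simpleTransition_eq]
      refine Finset.sum_congr rfl fun l hl => ?_
      have := Finset.mem_Icc.1 hl
      rw [Set.mem_Iic] at hm
      rw [if_neg (by omega), zero_add]
      split_ifs <;> first | rfl | omega
    · refine (Finset.sum_eq_zero fun l hl => ?_).symm
      rw [Set.mem_Iic] at hm
      split_ifs <;> first | rfl | omega
  rw [h]
  exact (hasSum_sum fun l _ => hasSum_ite_eq _ _).tsum_eq

/-- The extension by zero of a sequence to `ℤ`. -/
def extendZero (π : ℕ → ℝ) (i : ℤ) : ℝ := if 0 ≤ i then π i.toNat else 0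

@[simp] theorem extendZero_natCast (π : ℕ → ℝ) (n : ℕ) : extendZero π n = π n := by
  simp [extendZero]

theorem extendZero_of_neg (π : ℕ → ℝ) {i : ℤ} (h : i < 0) : extendZero π i = 0 := by
  simp [extendZero, h]

theorem hasSum_mul_simpleTransition (L : RandomLeap) (π : ℕ → ℝ) (j : ℤ) :
    HasSum (fun i : ℕ => π i * L.simpleTransition i j) (L.step (extendZero π) j) := by
  have h : HasSum (fun i : ℤ => extendZero π i * L.simpleTransition i j)
      (L.step (extendZero π) j) := by
    have e : (fun i : ℤ => extendZero π i * L.simpleTransition i j) = fun i =>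
        ∑ l ∈ Finset.Icc 1 L.k, ((if i = j - l then L.p l • extendZero π (j - l) else 0)
          + if i = j + l then L.q l • extendZero π (j + l) else 0) := by
      funext i
      rw [simpleTransition_eq, Finset.mul_sum]
      refine Finset.sum_congr rfl fun l _ => ?_
      rw [mul_add]
      congr 1
      all_goals
        split_ifs with h
        · rw [h, smul_eq_mul, mul_comm]
        · rw [mul_zero]
    rw [e]
    exact hasSum_sum fun l _ => (hasSum_ite_eq _ _).add (hasSum_ite_eq _ _)
  rw [← (Nat.cast_injective (R := ℤ)).hasSum_iff] at h
  · simpa [Function.comp_def] using h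
  · intro i hi
    rw [extendZero_of_neg, zero_mul]
    by_contra hn
    exact hi ⟨i.toNat, by simpa using hn⟩

theorem step_extendZero_of_isStationary {L : RandomLeap} {π : ℕ → ℝ}
    (h : IsStationaryDistribution L.reflectTransition π) (j : ℤ) (hj : 1 ≤ j) :
    L.step (extendZero π) j = extendZero π j := by
  lift j to ℕ using by omega
  refine (L.hasSum_mul_simpleTransition π j).unique ?_
  have hj0 : j ≠ 0 := by omega
  simpa only [reflectTransition, hj0, if_false, extendZero_natCast] using h.2.2 j

theorem not_isStationary_of_drift_nonneg (L : RandomLeap) (hd : 0 ≤ L.drift) (π : ℕ → ℝ) :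
    ¬ IsStationaryDistribution L.reflectTransition π := by
  intro h
  have hs : Summable fun n : ℕ => extendZero π n := by simpa using h.2.1.summable
  have hpos : 0 < π 0 := by
    refine lt_of_le_of_ne (h.1 0) fun h0 => ?_
    have hz : ∀ n : ℕ, π n = 0 := fun n => by
      have hk := (Finset.mem_Icc.1 L.kp_mem.1).1
      have := L.eq_zero_of_boundary_eq_zero (extendZero π) (step_extendZero_of_isStationary h)
        (fun i _ hi => by
          rcases eq_or_lt_of_le hi with rfl | hi
          · simpa [extendZero] using h0.symm
          · exact extendZero_of_neg π hi) hs.tendsto_atTop_zero n (by omega)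
      simpa using this
    exact zero_ne_one (hasSum_zero.unique (funext hz ▸ h.2.1 : HasSum (fun _ : ℕ => (0 : ℝ)) 1))
  exact absurd (L.drift_neg_of_summable (extendZero π) (step_extendZero_of_isStationary h)
    (fun i _ hi => extendZero_of_neg π hi) (by simpa [extendZero] using hpos) hs) (not_lt.2 hd)

theorem step_sub_smul (L : RandomLeap) (f g : ℤ → ℝ) (c : ℝ) (j : ℤ) :
    L.step (fun i => f i - c * g i) j = L.step f j - c * L.step g j := by
  rw [step, step, step, Finset.mul_sum, ← Finset.sum_sub_distrib]
  exact Finset.sum_congr rfl fun l _ => by simp only [smul_eq_mul]; ring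

/-- A summable solution of the stationarity equations that vanishes on the negative part of the
boundary yields, after normalization, the unique stationary distribution. -/
theorem isStationary_of_summable (L : RandomLeap) (f : ℤ → ℝ)
    (hf : ∀ j, 1 ≤ j → L.step f j = f j)
    (hb : ∀ i, 1 - (L.kp : ℤ) ≤ i → i < 0 → f i = 0) (hone : f 0 = 1)
    (hs : Summable fun n : ℕ => f n) :
    0 < ∑' n : ℕ, f n ∧
    IsStationaryDistribution L.reflectTransition (fun n : ℕ => f n / ∑' n : ℕ, f n) ∧
    ∀ π, IsStationaryDistribution L.reflectTransition π → 
      π = fun n : ℕ => f n / ∑' n : ℕ, f n := by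
  have h0 := hs.tendsto_atTop_zero
  have hk := (Finset.mem_Icc.1 L.kp_mem.1).1
  have hnn := L.nonneg_of_boundary_nonneg f hf (fun i h h' => by
    rcases eq_or_lt_of_le h' with rfl | h'
    · exact hone ▸ zero_le_one
    · exact (hb i h h').ge) h0
  set A := ∑' n : ℕ, f n with hA
  have hApos : 0 < A := hs.tsum_pos (fun n => hnn n (by omega)) 0 (by simp [hone])
  -- Below `1 - kp` the two sequences may differ, but the equations at `j ≥ 1` never look there.
  have hext : ∀ i, 1 - (L.kp : ℤ) ≤ i → extendZero (fun n : ℕ => f n) i = f i := by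
    intro i hi
    rcases lt_or_ge i 0 with h | h
    · rw [extendZero_of_neg _ h, hb i hi h]
    · simp [extendZero, h]
  have hstep : ∀ j, 1 ≤ j → L.step (extendZero fun n : ℕ => f n) j = f j := by
    intro j hj
    rw [← hf j hj, step, step]
    refine Finset.sum_congr rfl fun l _ => ?_
    rw [hext (j + l) (by omega)]
    rcases le_or_gt l L.kp with h | h
    · rw [hext _ (by omega)]
    · simp [L.p_eq_zero_of_kp_lt h]
  have hzero : HasSum (fun i : ℕ => f i * L.reflectTransition i 0) (f 0) := by
    have hsum : HasSum (fun i : ℕ => f i * L.reflectTransition i 0)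
        (∑ l ∈ Finset.Icc 1 L.k, L.q l * ∑ i ∈ Finset.range (l + 1), f i) := by
      have e : (fun i : ℕ => f i * L.reflectTransition i 0) = fun i => ∑ l ∈ Finset.Icc 1 L.k,
          L.q l * if i ∈ Finset.range (l + 1) then f i else 0 := by
        funext i
        rw [reflectTransition_zero, Finset.mul_sum]
        refine Finset.sum_congr rfl fun l _ => ?_
        simp only [Finset.mem_range, Nat.lt_succ_iff]
        split_ifs
        · ring
        · simp
      rw [e]
      refine hasSum_sum fun l _ => HasSum.mul_left _ ?_
      have h1 : HasSum (fun i : ℕ => if i ∈ Finset.range (l + 1) then f i else 0)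
          (∑ i ∈ Finset.range (l + 1), if i ∈ Finset.range (l + 1) then f i else 0) :=
        hasSum_sum_of_ne_finset_zero fun i hi => if_neg hi
      rwa [Finset.sum_congr rfl fun i hi => if_pos hi] at h1
    convert hsum using 1
    -- With this boundary data the upward flow across the cut at `0` is `∑ p_l`. Zero flow thus
    -- equates the inflow to `0` from positive states with `∑ p_l`; the self-loop adds `∑ q_l`.
    have hfl := L.flux_zero_eq_zero f hf h0
    have hp (l : ℕ) (hl : l ∈ Finset.Icc 1 L.k) :
        L.p l • ∑ t ∈ Finset.range l, f (0 - t) = L.p l := by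
      rcases le_or_gt l L.kp with h | h
      · rw [Finset.sum_eq_single_of_mem 0 (by have := Finset.mem_Icc.1 hl; simp; omega)]
        · simp [hone]
        · intro t ht hne
          have := Finset.mem_range.1 ht
          exact hb _ (by omega) (by omega)
      · simp [L.p_eq_zero_of_kp_lt h]
    rw [flux, Finset.sum_sub_distrib, Finset.sum_congr rfl hp, sub_eq_zero] at hfl
    have hq (l : ℕ) : L.q l * ∑ i ∈ Finset.range (l + 1), f i
        = L.q l • ∑ t ∈ Finset.range l, f (0 + 1 + t) + L.q l := by
      rw [Finset.sum_range_succ', Nat.cast_zero, hone, mul_add, mul_one, smul_eq_mul]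
      congr 3
      funext t
      congr 1
      push_cast
      ring
    simp only [hq, Finset.sum_add_distrib]
    rw [← hfl, ← Finset.sum_add_distrib, L.sum_eq_one, hone]
  refine ⟨hApos, ⟨fun i => div_nonneg (hnn i (by omega)) hApos.le, ?_, fun j => ?_⟩, ?_⟩
  · rw [← div_self hApos.ne']
    exact hs.hasSum.div_const A
  · simp only [div_mul_eq_mul_div]
    refine HasSum.div_const ?_ A
    rcases Nat.eq_zero_or_pos j with rfl | hj
    · simpa using hzero
    · have := L.hasSum_mul_simpleTransition (fun n : ℕ => f n) j
      rw [hstep j (by omega)] at this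
      simpa [reflectTransition, hj.ne'] using this
  · intro π hπ
    have hd : ∀ n : ℕ, π n = π 0 * f n := fun n => by
      have := L.eq_zero_of_boundary_eq_zero (fun i => extendZero π i - π 0 * f i)
        (fun j hj => by rw [step_sub_smul, hf j hj, step_extendZero_of_isStationary hπ j hj])
        (fun i hi hi' => by
          rcases eq_or_lt_of_le hi' with rfl | hi'
          · simp [extendZero, hone]
          · rw [extendZero_of_neg π hi', hb i hi hi', mul_zero, sub_zero])
        (by simpa using hπ.2.1.summable.tendsto_atTop_zero.sub (h0.const_mul (π 0))) n (by omega)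
      rw [sub_eq_zero, extendZero_natCast] at this
      exact this
    have h1 : π 0 * A = 1 := by
      refine (hs.hasSum.mul_left (π 0)).unique ?_
      simpa only [← hd] using hπ.2.1
    funext n
    rw [hd n, eq_div_iff hApos.ne', mul_right_comm, h1, one_mul]

/-! ### Exponential polynomials and the symbol `ψ` -/

/-- The shift operator on two-sided complex sequences. -/
def shift : Module.End ℂ (ℤ → ℂ) := LinearMap.funLeft ℂ ℂ fun i => i + 1

@[simp] theorem shift_apply (f : ℤ → ℂ) (i : ℤ) : shift f i = f (i + 1) := rfl

theorem shift_pow_apply (f : ℤ → ℂ) (n : ℕ) (i : ℤ) : (shift ^ n) f i = f (i + n) := by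
  induction n generalizing i with
  | zero => simp
  | succ n ih =>
    rw [pow_succ', Module.End.mul_apply, shift_apply, ih]
    congr 1
    push_cast
    ring

/-- The exponential polynomial `i ↦ P(i) y ^ i`. -/
def expPoly (y : ℂ) (P : ℂ[X]) (i : ℤ) : ℂ := P.eval (i : ℂ) * y ^ i

/-- One factor `shift - y` replaces `P` by `y` times its forward difference, which has smaller
degree. -/
theorem shift_sub_pow_expPoly {y : ℂ} (hy : y ≠ 0) (n : ℕ) (P : ℂ[X]) (hP : P.degree < n) :
    ((shift - y • (1 : Module.End ℂ (ℤ → ℂ))) ^ n) (expPoly y P) = 0 := by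
  induction n generalizing P with
  | zero =>
    have : P = 0 := by
      rw [← degree_eq_bot]
      simpa using hP
    subst this
    funext i
    simp [expPoly]
  | succ n ih =>
    have h : (shift - y • (1 : Module.End ℂ (ℤ → ℂ))) (expPoly y P)
        = expPoly y (C y * (taylor 1 P - P)) := by
      funext i
      simp [expPoly, taylor_eval, zpow_add₀ hy]
      ring
    rw [pow_succ, Module.End.mul_apply, h]
    refine ih _ ?_
    rw [degree_C_mul hy]
    rcases eq_or_ne P 0 with rfl | h0
    · simp
    · have h1 := degree_sub_lt_left (p := taylor (1 : ℂ) P) (q := P) (degree_taylor P 1)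
        (by simpa using h0) (leadingCoeff_taylor 1 P)
      rw [degree_taylor] at h1
      rw [degree_eq_natDegree h0] at h1 hP
      refine h1.trans_le ?_
      have : P.natDegree < n + 1 := by exact_mod_cast hP
      exact_mod_cast Nat.lt_succ_iff.1 this

/-- Blocks for distinct `y` lie in independent generalized eigenspaces of the shift; within a block,
a polynomial vanishing at all integers is zero. -/
theorem linearIndependent_expPoly {κ : Type*} [Fintype κ] (y : κ → ℂ) (hinj : Function.Injective y)
    (hy : ∀ j, y j ≠ 0) (r : κ → ℕ) :
    LinearIndependent ℂ fun x : Σ j, Fin (r j) => expPoly (y x.1) (X ^ (x.2 : ℕ)) := by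
  rw [Fintype.linearIndependent_iff]
  intro g hg
  set P : κ → ℂ[X] := fun j => ∑ l : Fin (r j), C (g ⟨j, l⟩) * X ^ (l : ℕ) with hP
  have hdeg (j : κ) : (P j).degree < r j := by
    rw [hP]
    refine (degree_sum_fin_lt fun l => g ⟨j, l⟩)
  have hsum : ∑ j, expPoly (y j) (P j) = 0 := by
    rw [← hg, Fintype.sum_sigma]
    refine Finset.sum_congr rfl fun j _ => ?_
    funext i
    simp [hP, expPoly, eval_finsetSum, Finset.sum_mul, mul_assoc]
  have hind := (Module.End.independent_maxGenEigenspace shift).comp hinj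
  rw [iSupIndep_iff_finsetSum_eq_zero_imp_eq_zero] at hind
  have hz := hind Finset.univ (fun j => expPoly (y j) (P j)) (fun j _ => by
    simp only [Function.comp_apply, Module.End.mem_maxGenEigenspace]
    exact ⟨r j, shift_sub_pow_expPoly (hy j) _ _ (hdeg j)⟩) hsum
  have hP0 (j : κ) : P j = 0 := by
    refine eq_zero_of_infinite_isRoot _ (Set.infinite_of_injective_forall_mem
      (f := fun n : ℤ => (n : ℂ)) Int.cast_injective fun i => ?_)
    have := congrFun (hz j (Finset.mem_univ j)) i
    simpa [expPoly, zpow_ne_zero _ (hy j)] using this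
  rintro ⟨j, l⟩
  have := congrArg (fun Q => Q.coeff l) (hP0 j)
  simpa [hP, coeff_X_pow, Fin.val_inj] using this

theorem sum_range_sum_Icc {V : Type*} [AddCommMonoid V] (k : ℕ) (w : ℕ → ℕ → V) :
    ∑ t ∈ Finset.range k, ∑ l ∈ Finset.Icc (t + 1) k, w l t
      = ∑ l ∈ Finset.Icc 1 k, ∑ t ∈ Finset.range l, w l t :=
  Finset.sum_comm' fun t l => by
    simp only [Finset.mem_range, Finset.mem_Icc]
    omega

/-- Grouping the flow by sites instead of step lengths leaves tail sums of `p` and `q`, which are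
the `γ_j`. The lower half is reversed since the upward windows run backwards. -/
theorem sum_gammaCoeff_mul (L : RandomLeap) (f : ℤ → ℂ) (i : ℤ) :
    ∑ j ∈ Finset.range (2 * L.k), (L.gammaCoeff j : ℂ) * f (i + j) = -L.flux f (i + L.k - 1) := by
  rw [two_mul, Finset.sum_range_add, ← Finset.sum_range_reflect, flux, Finset.sum_sub_distrib,
    neg_sub, sub_eq_neg_add, ← Finset.sum_neg_distrib]
  congr 1
  · simp only [Finset.smul_sum, ← Finset.sum_neg_distrib]
    rw [← sum_range_sum_Icc]
    refine Finset.sum_congr rfl fun t ht => ?_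
    have ht := Finset.mem_range.1 ht
    rw [gammaCoeff, if_pos (by omega), (by omega : L.k - (L.k - 1 - t) = t + 1)]
    push_cast [Finset.sum_mul, (by omega : 1 + t ≤ L.k), Nat.sub_sub]
    rw [neg_mul, Finset.sum_mul, ← Finset.sum_neg_distrib]
    refine Finset.sum_congr rfl fun l _ => ?_
    rw [Complex.real_smul]
    congr 3
    ring
  · simp only [Finset.smul_sum]
    rw [← sum_range_sum_Icc]
    refine Finset.sum_congr rfl fun t _ => ?_
    rw [gammaCoeff, if_neg (by omega), (by omega : L.k + t - L.k + 1 = t + 1)]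
    push_cast [Finset.sum_mul]
    refine Finset.sum_congr rfl fun l _ => ?_
    rw [Complex.real_smul]
    congr 2
    ring

theorem aeval_shift_psi_apply (L : RandomLeap) (f : ℤ → ℂ) (i : ℤ) :
    aeval shift L.psi f i = -L.flux f (i + L.k - 1) := by
  rw [← sum_gammaCoeff_mul, psi]
  simp [LinearMap.sum_apply, shift_pow_apply, Finset.sum_apply]

theorem eval_psi (L : RandomLeap) (y : ℂ) :
    L.psi.eval y = -L.flux (fun i => y ^ i) (L.k - 1) := by
  have := L.sum_gammaCoeff_mul (fun i => y ^ i) 0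
  rw [zero_add] at this
  rw [← this, psi]
  simp [eval_finsetSum]

theorem eval_one_psi (L : RandomLeap) : L.psi.eval 1 = -(L.drift : ℂ) := by
  rw [eval_psi, flux, drift]
  push_cast
  congr 1
  refine Finset.sum_congr rfl fun l _ => ?_
  simp
  ring

/-- `(X - y) ^ mult` divides `ψ`, so `ψ(shift)` annihilates the sequence; its flow is zero at every
cut, hence it is harmonic. -/
theorem step_expPoly (L : RandomLeap) {y : ℂ} (hy : y ≠ 0) (P : ℂ[X])
    (hP : P.degree < L.psi.rootMultiplicity y) (j : ℤ) :
    L.step (expPoly y P) j = expPoly y P j := by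
  obtain ⟨Q, hQ⟩ := L.psi.pow_rootMultiplicity_dvd y
  have hz : aeval shift L.psi (expPoly y P) = 0 := by
    rw [hQ, mul_comm, map_mul, Module.End.mul_apply, map_pow, map_sub, aeval_X, aeval_C,
      Algebra.algebraMap_eq_smul_one, shift_sub_pow_expPoly hy _ _ hP, map_zero]
  have hfl (i : ℤ) : L.flux (expPoly y P) i = 0 := by
    have := congrFun hz (i - L.k + 1)
    rw [aeval_shift_psi_apply, (by ring : i - L.k + 1 + L.k - 1 = i)] at this
    simpa using this
  have := L.flux_sub_flux (expPoly y P) (j - 1)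
  rw [hfl, hfl, sub_zero, sub_add_cancel] at this
  exact (sub_eq_zero.1 this.symm).symm

/-- On the unit circle, the real part of `∑ (p_l y⁻ˡ + q_l yˡ) = 1` forces `yˡ = 1` for every
possible step length `l`. The gcd condition leaves `y = 1`, where `ψ` equals `-drift ≠ 0`. -/
theorem norm_root_ne_one (L : RandomLeap)
    (hgcd : ((Finset.Icc 1 L.k).filter fun j => 0 < L.p j + L.q j).gcd id = 1)
    (hd : L.drift ≠ 0) {y : ℂ} (hy : L.psi.IsRoot y) : ‖y‖ ≠ 1 := by
  intro hn
  have hy0 : y ≠ 0 := by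
    rintro rfl
    simp at hn
  have hm : 0 < L.psi.rootMultiplicity y := (rootMultiplicity_pos L.psi_ne_zero).2 hy
  have hst := L.step_expPoly hy0 1 (by rw [degree_one]; exact_mod_cast hm) 0
  have hre (l : ℕ) : (y ^ (-(l : ℤ))).re = (y ^ l).re := by
    rw [zpow_neg, zpow_natCast, Complex.inv_eq_conj (by simp [hn]), Complex.conj_re]
  have hsum : ∑ l ∈ Finset.Icc 1 L.k, (L.p l + L.q l) * (1 - (y ^ l).re) = 0 := by
    have h1 := congrArg Complex.re hst
    simp only [step, expPoly, eval_one, one_mul, zero_sub, zero_add, Complex.re_sum,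
      Complex.add_re, Complex.smul_re, smul_eq_mul, hre, zpow_natCast, zpow_zero,
      Complex.one_re] at h1
    simp only [mul_sub, mul_one, Finset.sum_sub_distrib, L.sum_eq_one]
    simp only [add_mul, h1, sub_self]
  have hle (l : ℕ) : (y ^ l).re ≤ 1 := (Complex.re_le_norm _).trans (by simp [hn])
  have hzero := (Finset.sum_eq_zero_iff_of_nonneg fun l _ =>
    mul_nonneg (add_nonneg (L.p_nonneg l) (L.q_nonneg l)) (sub_nonneg.2 (hle l))).1 hsum
  have hdvd : orderOf y ∣ 1 := by
    rw [← hgcd]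
    refine Finset.dvd_gcd fun l hl => ?_
    rw [Finset.mem_filter] at hl
    rw [id, orderOf_dvd_iff_pow_eq_one]
    have h1 : (y ^ l).re = 1 := by
      have := (mul_eq_zero.1 (hzero l hl.1)).resolve_left hl.2.ne'
      linarith
    have h2 : Complex.normSq (y ^ l) = 1 := by
      rw [Complex.normSq_eq_norm_sq]
      simp [hn]
    rw [Complex.normSq_apply, h1] at h2
    refine Complex.ext h1 ?_
    have : (y ^ l).im * (y ^ l).im = 0 := by linarith
    simpa using this
  have hy1 : y = 1 := orderOf_eq_one_iff.1 (Nat.dvd_one.1 hdvd)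
  rw [hy1, IsRoot, eval_one_psi] at hy
  exact hd (by simpa using hy)

/-! ### Dimension of the space of decaying harmonic sequences -/

/-- The harmonic sequences that are summable at `+∞`. -/
def decaying (L : RandomLeap) : Submodule ℂ (ℤ → ℂ) where
  carrier := {f | (∀ j, L.step f j = f j) ∧ Summable fun n : ℕ => f n}
  add_mem' := by
    rintro f g ⟨hf, hf'⟩ ⟨hg, hg'⟩
    refine ⟨fun j => ?_, hf'.add hg'⟩
    rw [Pi.add_apply, ← hf, ← hg, step, step, step, ← Finset.sum_add_distrib]
    exact Finset.sum_congr rfl fun l _ => by simp only [Pi.add_apply]; module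
  zero_mem' := ⟨fun j => by simp [step], by simp⟩
  smul_mem' := by
    rintro c f ⟨hf, hf'⟩
    refine ⟨fun j => ?_, hf'.const_smul c⟩
    rw [Pi.smul_apply, ← hf, step, step, Finset.smul_sum]
    exact Finset.sum_congr rfl fun l _ => by
      simp only [Pi.smul_apply, Complex.real_smul, smul_eq_mul]
      ring

theorem expPoly_mem_decaying (L : RandomLeap) {y : ℂ} (hy : y ≠ 0) (h1 : ‖y‖ < 1) (l : ℕ)
    (hl : l < L.psi.rootMultiplicity y) : expPoly y (X ^ l) ∈ L.decaying :=
  ⟨L.step_expPoly hy _ (by rw [degree_X_pow]; exact_mod_cast hl),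
    by simpa [expPoly] using summable_pow_mul_geometric_of_norm_lt_one l h1⟩

theorem eq_zero_of_mem_decaying (L : RandomLeap) {f : ℤ → ℂ} (hf : f ∈ L.decaying)
    (hb : ∀ i, 1 - (L.kp : ℤ) ≤ i → i ≤ 0 → f i = 0) : f = 0 := by
  have h0 := hf.2.tendsto_atTop_zero
  have hk := (Finset.mem_Icc.1 L.kp_mem.1).1
  refine L.eq_zero_of_forall_nonneg f hf.1 fun i hi => Complex.ext ?_ ?_
  · refine L.eq_zero_of_boundary_eq_zero (fun i => (f i).re) (fun j _ => ?_)
      (fun i h h' => by simp [hb i h h']) ?_ i (by omega)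
    · rw [← hf.1 j]
      exact (L.map_step Complex.reLm f j).symm
    · exact (Complex.continuous_re.tendsto 0).comp h0
  · refine L.eq_zero_of_boundary_eq_zero (fun i => (f i).im) (fun j _ => ?_)
      (fun i h h' => by simp [hb i h h']) ?_ i (by omega)
    · rw [← hf.1 j]
      exact (L.map_step Complex.imLm f j).symm
    · exact (Complex.continuous_im.tendsto 0).comp h0

/-- Restriction of a decaying harmonic sequence to the first `n` boundary points. -/
def boundary (L : RandomLeap) (n : ℕ) : L.decaying →ₗ[ℂ] (Fin n → ℂ) :=
  LinearMap.funLeft ℂ ℂ (fun a : Fin n => (a : ℤ) + 1 - L.kp) ∘ₗ L.decaying.subtype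

theorem boundary_apply (L : RandomLeap) (n : ℕ) (f : L.decaying) (a : Fin n) :
    L.boundary n f a = (f : ℤ → ℂ) (a + 1 - L.kp) := rfl

theorem boundary_injective (L : RandomLeap) : Function.Injective (L.boundary L.kp) := by
  rw [← LinearMap.ker_eq_bot, LinearMap.ker_eq_bot']
  intro f hf
  refine Subtype.ext (L.eq_zero_of_mem_decaying f.2 fun i hi hi' => ?_)
  have := congrFun hf ⟨(i - 1 + L.kp).toNat, by omega⟩
  rw [boundary_apply, Pi.zero_apply] at this
  rw [← this]
  refine congrArg (f : ℤ → ℂ) ?_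
  change i = ((i - 1 + L.kp).toNat : ℤ) + 1 - L.kp
  omega

theorem boundary_injective_of_drift_nonneg (L : RandomLeap) (hd : 0 ≤ L.drift) :
    Function.Injective (L.boundary (L.kp - 1)) := by
  rw [← LinearMap.ker_eq_bot, LinearMap.ker_eq_bot']
  intro f hf
  have hb : ∀ i, 1 - (L.kp : ℤ) ≤ i → i < 0 → (f : ℤ → ℂ) i = 0 := by
    intro i hi hi'
    have := congrFun hf ⟨(i - 1 + L.kp).toNat, by omega⟩
    rw [boundary_apply, Pi.zero_apply] at this
    rw [← this]
    refine congrArg (f : ℤ → ℂ) ?_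
    change i = ((i - 1 + L.kp).toNat : ℤ) + 1 - L.kp
    omega
  refine Subtype.ext (L.eq_zero_of_mem_decaying f.2 fun i hi hi' => ?_)
  rcases hi'.lt_or_eq with hi' | rfl
  · exact hb i hi hi'
  by_contra hne
  -- Rotating by the conjugate of `f 0` gives a real solution positive at `0`, which would force
  -- negative drift.
  let φ : ℂ →ₗ[ℝ] ℝ := Complex.reLm ∘ₗ LinearMap.mulLeft ℝ ((starRingEnd ℂ) ((f : ℤ → ℂ) 0))
  refine absurd (L.drift_neg_of_summable (fun i => φ ((f : ℤ → ℂ) i)) (fun j _ => ?_)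
    (fun i h h' => by rw [hb i h h', map_zero]) ?_ ?_) (not_lt.2 hd)
  · rw [← L.map_step φ, f.2.1 j]
  · have : φ ((f : ℤ → ℂ) 0) = Complex.normSq ((f : ℤ → ℂ) 0) := by
      simp [φ, Complex.normSq_apply]
    rw [this]
    exact Complex.normSq_pos.2 hne
  · exact f.2.2.mapL (LinearMap.toContinuousLinearMap φ)

instance (L : RandomLeap) : FiniteDimensional ℂ L.decaying :=
  FiniteDimensional.of_injective _ L.boundary_injective

theorem finrank_decaying_le (L : RandomLeap) : Module.finrank ℂ L.decaying ≤ L.kp := by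
  simpa using LinearMap.finrank_le_finrank_of_injective L.boundary_injective

theorem finrank_decaying_le_of_drift_nonneg (L : RandomLeap) (hd : 0 ≤ L.drift) :
    Module.finrank ℂ L.decaying ≤ L.kp - 1 := by
  simpa using LinearMap.finrank_le_finrank_of_injective (L.boundary_injective_of_drift_nonneg hd)

theorem card_le_finrank_decaying (L : RandomLeap) {ι : Type*} [Fintype ι] {v : ι → ℤ → ℂ}
    (hv : LinearIndependent ℂ v) (hm : ∀ x, v x ∈ L.decaying) :
    Fintype.card ι ≤ Module.finrank ℂ L.decaying :=
  LinearIndependent.fintype_card_le_finrank (b := fun x => (⟨v x, hm x⟩ : L.decaying))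
    (LinearIndependent.of_comp L.decaying.subtype hv)

/-! ### Reflection and the count of roots -/

/-- The random leap with upward and downward steps exchanged. -/
def swap (L : RandomLeap) : RandomLeap where
  k := L.k
  p := L.q
  q := L.p
  one_le_k := L.one_le_k
  p_nonneg := L.q_nonneg
  q_nonneg := L.p_nonneg
  p_support := L.q_support
  q_support := L.p_support
  sum_eq_one := by simpa only [add_comm] using L.sum_eq_one
  sum_p_pos := L.sum_q_pos
  sum_q_pos := L.sum_p_pos

theorem drift_swap (L : RandomLeap) : L.swap.drift = -L.drift := by
  rw [drift, drift, ← Finset.sum_neg_distrib]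
  exact Finset.sum_congr rfl fun l _ => by simp only [swap]; ring

theorem step_swap (L : RandomLeap) (f : ℤ → ℂ) (j : ℤ) :
    L.swap.step (fun i => f (-i)) j = L.step f (-j) := by
  refine Finset.sum_congr rfl fun l _ => ?_
  simp only [swap]
  rw [add_comm, neg_add', neg_sub, sub_eq_neg_add (l : ℤ), add_comm (-j)]

theorem expPoly_neg_mem_decaying_swap (L : RandomLeap) {y : ℂ} (h1 : 1 < ‖y‖) (l : ℕ)
    (hl : l < L.psi.rootMultiplicity y) :
    (fun i => expPoly y (X ^ l) (-i)) ∈ L.swap.decaying := by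
  have hy : y ≠ 0 := by
    rintro rfl
    norm_num at h1
  refine ⟨fun j => ?_, ?_⟩
  · rw [step_swap, L.step_expPoly hy _ (by rw [degree_X_pow]; exact_mod_cast hl)]
  · have := (summable_pow_mul_geometric_of_norm_lt_one l (r := y⁻¹)
      (by rw [norm_inv]; exact inv_lt_one_of_one_lt₀ h1)).mul_left ((-1) ^ l)
    refine this.congr fun n => ?_
    simp only [expPoly, eval_pow, eval_X, Int.cast_neg, Int.cast_natCast, zpow_neg, zpow_natCast,
      inv_pow]
    rw [neg_pow (n : ℂ)]
    ring

namespace RootOrdering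

variable {L : RandomLeap} (R : L.RootOrdering)

theorem y_ne_zero (j : Fin R.s) : R.y j ≠ 0 :=
  (R.range_eq ▸ Set.mem_range_self j : R.y j ∈ {z : ℂ | z ≠ 0 ∧ L.psi.IsRoot z}).1

theorem isRoot_y (j : Fin R.s) : L.psi.IsRoot (R.y j) :=
  (R.range_eq ▸ Set.mem_range_self j : R.y j ∈ {z : ℂ | z ≠ 0 ∧ L.psi.IsRoot z}).2

theorem linearIndependent_expPoly_subtype (p : Fin R.s → Prop) [DecidablePred p] :
    LinearIndependent ℂ fun x : Σ j : {j // p j}, Fin (R.mult j) =>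
      expPoly (R.y x.1) (X ^ (x.2 : ℕ)) :=
  linearIndependent_expPoly (fun j : {j // p j} => R.y j)
    (R.injective.comp Subtype.val_injective) (fun j => R.y_ne_zero j) fun j => R.mult j

theorem card_sigma_subtype (p : Fin R.s → Prop) [DecidablePred p] :
    Fintype.card (Σ j : {j // p j}, Fin (R.mult j)) = ∑ j ∈ Finset.univ.filter p, R.mult j := by
  rw [Fintype.card_sigma, Finset.sum_subtype (p := p) (F := inferInstance) _ (by simp)]
  simp

theorem sum_mult_norm_lt_one_le : ∑ j ∈ Finset.univ.filter (fun j => ‖R.y j‖ < 1), R.mult j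
    ≤ L.kp := by
  rw [← card_sigma_subtype]
  exact (L.card_le_finrank_decaying (R.linearIndependent_expPoly_subtype _) fun x =>
    L.expPoly_mem_decaying (R.y_ne_zero _) x.1.2 _ x.2.2).trans L.finrank_decaying_le

/-- Reflected, these roots give independent decaying sequences for `swap`, whose drift is
nonnegative; this is what saves one dimension from `kq`. -/
theorem sum_mult_one_lt_norm_le (hd : L.drift ≤ 0) :
    ∑ j ∈ Finset.univ.filter (fun j => 1 < ‖R.y j‖), R.mult j ≤ L.kq - 1 := by
  rw [← card_sigma_subtype]
  have hli := (R.linearIndependent_expPoly_subtype fun j => 1 < ‖R.y j‖).map'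
    (LinearMap.funLeft ℂ ℂ fun i : ℤ => -i)
    (LinearMap.ker_eq_bot.2 (LinearMap.funLeft_injective_of_surjective _ _ _ neg_surjective))
  exact (L.swap.card_le_finrank_decaying hli fun x =>
    L.expPoly_neg_mem_decaying_swap x.1.2 _ x.2.2).trans
    (L.swap.finrank_decaying_le_of_drift_nonneg (by rw [drift_swap]; linarith))

/-- The degree is at least `k + kq - 1`, and the root `0` accounts for at most `k - kp` of it. -/
theorem le_sum_mult : L.kp + L.kq - 1 ≤ ∑ j, R.mult j := by
  classical
  have hp := Finset.mem_Icc.1 L.kp_mem.1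
  have hq := Finset.mem_Icc.1 L.kq_mem.1
  have hdeg : L.k + L.kq - 1 ≤ L.psi.natDegree := le_natDegree_of_ne_zero L.psi_coeff_high_ne
  have hmul : L.psi.roots.count 0 ≤ L.k - L.kp := by
    rw [count_roots, rootMultiplicity_eq_natTrailingDegree']
    exact natTrailingDegree_le_of_ne_zero L.psi_coeff_low_ne
  have hcard : L.psi.roots.card = L.psi.natDegree :=
    (IsAlgClosed.splits L.psi).natDegree_eq_card_roots.symm
  have hsum : ∑ j, R.mult j = ∑ z ∈ Finset.univ.image R.y, L.psi.roots.count z := by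
    rw [Finset.sum_image (fun a _ b _ h => R.injective h)]
    simp [RootOrdering.mult]
  have hsub : L.psi.roots.toFinset ⊆ insert 0 (Finset.univ.image R.y) := by
    intro z hz
    rcases eq_or_ne z 0 with rfl | h0
    · simp
    · have : z ∈ Set.range R.y := by
        rw [R.range_eq]
        exact ⟨h0, isRoot_of_mem_roots (Multiset.mem_toFinset.1 hz)⟩
      simpa [h0] using this
  have htot : L.psi.natDegree ≤ L.psi.roots.count 0 + ∑ j, R.mult j := by
    rw [hsum, ← hcard, ← Multiset.toFinset_sum_count_eq]
    refine (Finset.sum_le_sum_of_subset hsub).trans ?_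
    rw [Finset.sum_insert]
    simpa using R.y_ne_zero
  omega

theorem sum_mult_norm_lt_one
    (hgcd : ((Finset.Icc 1 L.k).filter fun j => 0 < L.p j + L.q j).gcd id = 1)
    (hd : L.drift < 0) :
    ∑ j ∈ Finset.univ.filter (fun j => ‖R.y j‖ < 1), R.mult j = L.kp := by
  have h1 := R.sum_mult_norm_lt_one_le
  have h2 := R.sum_mult_one_lt_norm_le hd.le
  have h3 := R.le_sum_mult
  have hq := Finset.mem_Icc.1 L.kq_mem.1
  rw [← Finset.sum_filter_add_sum_filter_not _ fun j => ‖R.y j‖ < 1] at h3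
  have h4 : Finset.univ.filter (fun j => ¬ ‖R.y j‖ < 1)
      = Finset.univ.filter fun j => 1 < ‖R.y j‖ := by
    refine Finset.filter_congr fun j _ => ?_
    rw [not_lt]
    exact ⟨fun h => lt_of_le_of_ne h (L.norm_root_ne_one hgcd hd.ne (R.isRoot_y j)).symm, le_of_lt⟩
  rw [h4] at h3
  omega

end RootOrdering

/-! ### Increments and the vector `η` -/

theorem sum_Icc_kp (L : RandomLeap) (w : ℕ → ℝ) :
    ∑ l ∈ Finset.Icc 1 L.kp, w l * L.p l = ∑ l ∈ Finset.Icc 1 L.k, w l * L.p l := by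
  have hk := (Finset.mem_Icc.1 L.kp_mem.1).2
  refine Finset.sum_subset (Finset.Icc_subset_Icc_right hk) fun l hl hl' => ?_
  rw [Finset.mem_Icc] at hl hl'
  rw [L.p_eq_zero_of_kp_lt (by omega), mul_zero]

theorem sum_Icc_kq (L : RandomLeap) (w : ℕ → ℝ) :
    ∑ l ∈ Finset.Icc 1 L.kq, w l * L.q l = ∑ l ∈ Finset.Icc 1 L.k, w l * L.q l :=
  L.swap.sum_Icc_kp w

theorem drift_eq (L : RandomLeap) : L.drift = ∑ l ∈ Finset.Icc 1 L.k, (l : ℝ) * L.p l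
    - ∑ l ∈ Finset.Icc 1 L.k, (l : ℝ) * L.q l := by
  simp only [drift, mul_sub, Finset.sum_sub_distrib]

theorem comp_sub_one_mem_decaying (L : RandomLeap) {f : ℤ → ℂ} (hf : f ∈ L.decaying) :
    (fun i => f (i - 1)) ∈ L.decaying := by
  refine ⟨fun j => ?_, ?_⟩
  · simp only [← hf.1 (j - 1), step]
    exact Finset.sum_congr rfl fun l _ => by rw [sub_right_comm, sub_add_eq_add_sub]
  · rw [← summable_nat_add_iff 1]
    simpa using hf.2

/-- The difference operator is injective here, as a constant sequence tending to zero vanishes;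
finite dimension makes it surjective. -/
theorem exists_mem_decaying_sub (L : RandomLeap) {g : ℤ → ℂ} (hg : g ∈ L.decaying) :
    ∃ f ∈ L.decaying, ∀ i, f i - f (i - 1) = g i := by
  let D : (ℤ → ℂ) →ₗ[ℂ] (ℤ → ℂ) := LinearMap.id - LinearMap.funLeft ℂ ℂ fun i => i - 1
  have hD : ∀ f i, D f i = f i - f (i - 1) := fun _ _ => rfl
  have hmem : ∀ f ∈ L.decaying, D f ∈ L.decaying := fun f hf =>
    L.decaying.sub_mem hf (L.comp_sub_one_mem_decaying hf)
  have hinj : Function.Injective (D.restrict hmem) := by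
    rw [← LinearMap.ker_eq_bot, LinearMap.ker_eq_bot']
    rintro ⟨f, hf⟩ h
    have hstep : ∀ i, f (i - 1) = f i := by
      intro i
      have := congrFun (congrArg Subtype.val h) i
      simp only [LinearMap.coe_restrict_apply, hD] at this
      exact (sub_eq_zero.1 this).symm
    have hup : ∀ n : ℕ, f n = f 0 := by
      intro n
      induction n with
      | zero => rfl
      | succ n ih =>
        rw [← ih, ← hstep]
        simp
    have h0 : f 0 = 0 := tendsto_nhds_unique
      (by simp only [hup]; exact tendsto_const_nhds) hf.2.tendsto_atTop_zero
    have hdown : ∀ n : ℕ, f (-n) = f 0 := by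
      intro n
      induction n with
      | zero => rfl
      | succ n ih =>
        rw [← ih, ← hstep (-n)]
        congr 1
        push_cast
        ring
    refine Subtype.ext (funext fun i => ?_)
    change f i = 0
    rcases le_total 0 i with hi | hi
    · lift i to ℕ using hi
      rw [hup, h0]
    · have := hdown (-i).toNat
      rwa [Int.toNat_of_nonneg (by omega), neg_neg, h0] at this
  obtain ⟨⟨f, hf⟩, hfg⟩ := LinearMap.injective_iff_surjective.1 hinj ⟨g, hg⟩
  exact ⟨f, hf, fun i => congrFun (congrArg Subtype.val hfg) i⟩

theorem eta_eq_zero (L : RandomLeap) (m : ℕ)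
    (hm : m ∉ Finset.Ico (L.kp - 1) (L.kp - 1 + L.kq)) : L.eta m = 0 := by
  have hp := Finset.mem_Icc.1 L.kp_mem.1
  rw [Finset.mem_Ico] at hm
  rw [eta, if_neg (by omega)]

theorem sum_range_mul_sub (f : ℤ → ℂ) (l : ℕ) :
    ∑ t ∈ Finset.range l, ((l : ℂ) - t) * (f (t + 1) - f t)
      = ∑ t ∈ Finset.range l, f (t + 1) - l * f 0 := by
  induction l with
  | zero => simp
  | succ l ih =>
    have h := Finset.sum_range_sub (fun t : ℕ => f t) l
    simp only [Nat.cast_add, Nat.cast_one, Nat.cast_zero] at h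
    have e : ∑ t ∈ Finset.range l, (((l + 1 : ℕ) : ℂ) - t) * (f (t + 1) - f t)
        = ∑ t ∈ Finset.range l, ((l : ℂ) - t) * (f (t + 1) - f t)
          + ∑ t ∈ Finset.range l, (f (t + 1) - f t) := by
      rw [← Finset.sum_add_distrib]
      exact Finset.sum_congr rfl fun t _ => by push_cast; ring
    rw [Finset.sum_range_succ, e, ih, h, Finset.sum_range_succ]
    push_cast
    ring

/-- With `m = kp - 1 + t`, `η` weights the increment from `t` to `t + 1` by `∑ (l - t) q_l`;
summation by parts recovers the downward flow across the cut at `0`. -/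
theorem tsum_eta_mul (L : RandomLeap) (f : ℤ → ℂ) :
    ∑' m : ℕ, (L.eta m : ℂ) * (f (m + 2 - L.kp) - f (m + 1 - L.kp))
      = ∑ l ∈ Finset.Icc 1 L.k, L.q l • ∑ t ∈ Finset.range l, f (t + 1)
        - ((∑ l ∈ Finset.Icc 1 L.k, (l : ℝ) * L.q l : ℝ) : ℂ) * f 0 := by
  have hp := Finset.mem_Icc.1 L.kp_mem.1
  rw [tsum_eq_sum (s := Finset.Ico (L.kp - 1) (L.kp - 1 + L.kq))
    (fun m hm => by rw [L.eta_eq_zero m hm]; simp), Finset.sum_Ico_eq_sum_range,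
    Nat.add_sub_cancel_left]
  have h1 : ∀ t ∈ Finset.range L.kq, (L.eta (L.kp - 1 + t) : ℂ)
      * (f ((L.kp - 1 + t : ℕ) + 2 - L.kp) - f ((L.kp - 1 + t : ℕ) + 1 - L.kp))
      = ∑ l ∈ Finset.Icc (t + 1) L.kq, (L.q l : ℂ) * (((l : ℂ) - t) * (f (t + 1) - f t)) := by
    intro t ht
    have ht := Finset.mem_range.1 ht
    rw [eta, if_pos (by omega), (by omega : L.kp - 1 + t + 1 - L.kp + 1 = t + 1),
      (by omega : ((L.kp - 1 + t : ℕ) : ℤ) + 2 - L.kp = t + 1),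
      (by omega : ((L.kp - 1 + t : ℕ) : ℤ) + 1 - L.kp = t)]
    push_cast [hp.1]
    rw [Finset.sum_mul]
    exact Finset.sum_congr rfl fun l _ => by ring
  rw [Finset.sum_congr rfl h1, sum_range_sum_Icc]
  simp only [← Finset.mul_sum, sum_range_mul_sub]
  have h2 : ∑ l ∈ Finset.Icc 1 L.kq,
      (L.q l : ℂ) * (∑ t ∈ Finset.range l, f (t + 1) - l * f 0) = ∑ l ∈ Finset.Icc 1 L.k,
      (L.q l : ℂ) * (∑ t ∈ Finset.range l, f (t + 1) - l * f 0) := by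
    have hk := (Finset.mem_Icc.1 L.kq_mem.1).2
    refine Finset.sum_subset (Finset.Icc_subset_Icc_right hk) fun l hl hl' => ?_
    rw [Finset.mem_Icc] at hl hl'
    rw [L.q_eq_zero_of_kq_lt (by omega), Complex.ofReal_zero, zero_mul]
  rw [h2]
  push_cast
  rw [Finset.sum_mul, ← Finset.sum_sub_distrib]
  exact Finset.sum_congr rfl fun l _ => by rw [Complex.real_smul]; ring

/-! ### The columns of `Ψ` and the action of `Ω_i` -/

namespace RootOrdering

variable {L : RandomLeap} (R : L.RootOrdering)

/-- The exponential polynomial whose values form the column `c` of `Ψ`. -/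
def colSeq (c : Fin L.kp) : ℤ → ℂ :=
  expPoly (R.y (R.column c).1) (X ^ ((R.column c).2 : ℕ))

theorem Psi_apply (m : ℕ) (c : Fin L.kp) : R.Psi m c = R.colSeq c (m + 2 - L.kp) := by
  simp [Psi, colSeq, expPoly]

theorem column_injective : Function.Injective R.column :=
  finSigmaFinEquiv.symm.injective.comp (Fin.castLE_injective R.kp_le_sum_mult)

theorem linearIndependent_colSeq : LinearIndependent ℂ R.colSeq :=
  (linearIndependent_expPoly R.y R.injective R.y_ne_zero R.mult).comp R.column R.column_injective

/-- Were this root not inside the disc, the ordering would put all roots inside it in earlier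
blocks. These fill `kp` columns, too many to precede column `c`. -/
theorem norm_column_lt_one
    (hgcd : ((Finset.Icc 1 L.k).filter fun j => 0 < L.p j + L.q j).gcd id = 1)
    (hd : L.drift < 0) (c : Fin L.kp) : ‖R.y (R.column c).1‖ < 1 := by
  by_contra hc
  have h1 : (finSigmaFinEquiv (R.column c) : ℕ) = c := by
    simp [column]
  rw [finSigmaFinEquiv_apply] at h1
  have h2 : ∑ j ∈ Finset.univ.filter (fun j => ‖R.y j‖ < 1), R.mult j
      ≤ ∑ i : Fin (R.column c).1, R.mult (Fin.castLE (R.column c).1.2.le i) := by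
    have : ∑ i : Fin (R.column c).1, R.mult (Fin.castLE (R.column c).1.2.le i)
        = ∑ j ∈ Finset.univ.map (Fin.castLEEmb (R.column c).1.2.le), R.mult j := by
      rw [Finset.sum_map]
      rfl
    rw [this]
    refine Finset.sum_le_sum_of_subset fun j hj => ?_
    rw [Finset.mem_filter] at hj
    have hlt : j < (R.column c).1 := by
      by_contra! hle
      exact hc ((R.mono hle).trans_lt hj.2)
    exact Finset.mem_map.2 ⟨⟨j, hlt⟩, Finset.mem_univ _, rfl⟩
  rw [R.sum_mult_norm_lt_one hgcd hd] at h2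
  have := c.2
  omega

theorem colSeq_mem_decaying
    (hgcd : ((Finset.Icc 1 L.k).filter fun j => 0 < L.p j + L.q j).gcd id = 1)
    (hd : L.drift < 0) (c : Fin L.kp) : R.colSeq c ∈ L.decaying :=
  L.expPoly_mem_decaying (R.y_ne_zero _) (R.norm_column_lt_one hgcd hd c) _ (R.column c).2.2

theorem finrank_decaying (R : L.RootOrdering)
    (hgcd : ((Finset.Icc 1 L.k).filter fun j => 0 < L.p j + L.q j).gcd id = 1)
    (hd : L.drift < 0) : Module.finrank ℂ L.decaying = L.kp := by
  refine le_antisymm L.finrank_decaying_le ?_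
  simpa using L.card_le_finrank_decaying R.linearIndependent_colSeq
    (R.colSeq_mem_decaying hgcd hd)

theorem exists_eq_sum_colSeq
    (hgcd : ((Finset.Icc 1 L.k).filter fun j => 0 < L.p j + L.q j).gcd id = 1)
    (hd : L.drift < 0) {g : ℤ → ℂ} (hg : g ∈ L.decaying) :
    ∃ v : Fin L.kp → ℂ, ∀ i, ∑ c, v c * R.colSeq c i = g i := by
  have hli : LinearIndependent ℂ fun c =>
      (⟨R.colSeq c, R.colSeq_mem_decaying hgcd hd c⟩ : L.decaying) :=
    LinearIndependent.of_comp L.decaying.subtype R.linearIndependent_colSeq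
  have htop := hli.span_eq_top_of_card_eq_finrank' (by simp [R.finrank_decaying hgcd hd])
  have hmem : (⟨g, hg⟩ : L.decaying) ∈ Submodule.span ℂ (Set.range fun c =>
      (⟨R.colSeq c, R.colSeq_mem_decaying hgcd hd c⟩ : L.decaying)) := htop ▸ Submodule.mem_top
  obtain ⟨v, hv⟩ := (Submodule.mem_span_range_iff_exists_fun ℂ).1 hmem
  refine ⟨v, fun i => ?_⟩
  have := congrFun (congrArg Subtype.val hv) i
  simpa [Submodule.coe_sum, Finset.sum_apply] using this

/-- Restriction to the boundary is injective between spaces of dimension `kp`, hence surjective. -/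
theorem exists_decaying_single (R : L.RootOrdering)
    (hgcd : ((Finset.Icc 1 L.k).filter fun j => 0 < L.p j + L.q j).gcd id = 1)
    (hd : L.drift < 0) : ∃ f ∈ L.decaying,
    (∀ i, 1 - (L.kp : ℤ) ≤ i → i < 0 → f i = 0) ∧ f 0 = 1 := by
  have hk := (Finset.mem_Icc.1 L.kp_mem.1).1
  have hs : Function.Surjective (L.boundary L.kp) :=
    (LinearMap.injective_iff_surjective_of_finrank_eq_finrank
      (by simp [R.finrank_decaying hgcd hd])).1 L.boundary_injective
  obtain ⟨f, hf⟩ := hs fun a => if (a : ℕ) + 1 = L.kp then 1 else 0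
  have hval (i : ℤ) (hi : 1 - (L.kp : ℤ) ≤ i) (hi' : i ≤ 0) :
      (f : ℤ → ℂ) i = if i = 0 then 1 else 0 := by
    have := congrFun hf ⟨(i - 1 + L.kp).toNat, by omega⟩
    rw [boundary_apply] at this
    simp only at this
    rw [(by omega : ((i - 1 + L.kp).toNat : ℤ) + 1 - L.kp = i)] at this
    rw [this]
    exact if_congr (by omega) rfl rfl
  refine ⟨f, f.2, fun i hi hi' => ?_, ?_⟩
  · rw [hval i hi hi'.le, if_neg hi'.ne]
  · rw [hval 0 (by omega) le_rfl, if_pos rfl]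

theorem sum_tsum_mul_Psi (w : ℕ → ℂ) (s : Finset ℕ) (hw : ∀ m ∉ s, w m = 0) (v : Fin L.kp → ℂ) :
    ∑ c, (∑' m, w m * R.Psi m c) * v c
      = ∑' m : ℕ, w m * ∑ c, v c * R.colSeq c (m + 2 - L.kp) := by
  rw [tsum_eq_sum (s := s) fun m hm => by rw [hw m hm, zero_mul]]
  have h (c : Fin L.kp) : ∑' m, w m * R.Psi m c = ∑ m ∈ s, w m * R.Psi m c :=
    tsum_eq_sum fun m hm => by rw [hw m hm, zero_mul]
  simp only [h, Finset.sum_mul, Finset.mul_sum]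
  rw [Finset.sum_comm]
  refine Finset.sum_congr rfl fun m _ => Finset.sum_congr rfl fun c _ => ?_
  rw [Psi_apply]
  ring

/-- The identity rows read off boundary increments of `f`; the row of `i` ones telescopes. -/
theorem Omega_mulVec_inl (i : ℕ) (f : ℤ → ℂ) (v : Fin L.kp → ℂ) (x : ℂ)
    (hv : ∀ j, ∑ c, v c * R.colSeq c j = f j - f (j - 1)) (a : Fin L.kp) :
    (R.Omega i).mulVec (Sum.elim v fun _ => x) (Sum.inl a) =
      if (a : ℕ) + 1 < L.kp then
        f (a + 2 - L.kp) - f (a + 1 - L.kp) + if (a : ℕ) + 2 = L.kp then x else 0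
      else f i - f 0 - x := by
  have hk := (Finset.mem_Icc.1 L.kp_mem.1).1
  have ha := a.2
  have h1 := R.sum_tsum_mul_Psi (L.halfAccordion i a) (Finset.range (L.kp + i)) (fun m hm => by
    rw [Finset.mem_range] at hm
    simp only [halfAccordion, Matrix.of_apply]
    split_ifs <;> first | rfl | omega) v
  rw [Matrix.mulVec, dotProduct, Fintype.sum_sum_type]
  simp only [Omega, Matrix.fromBlocks_apply₁₁, Matrix.fromBlocks_apply₁₂, Matrix.of_apply,
    Sum.elim_inl, Sum.elim_inr, h1, hv, Finset.univ_unique, Finset.sum_singleton]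
  simp only [halfAccordion, Matrix.of_apply]
  split_ifs with h2 h3 h4 h4 <;> try omega
  · simp only [ite_mul, one_mul, zero_mul, tsum_ite_eq]
    rw [sub_zero, one_mul]
    congr 3
    ring
  · simp only [ite_mul, one_mul, zero_mul, tsum_ite_eq]
    rw [sub_zero, zero_mul]
    congr 3
    ring
  · rw [tsum_eq_sum (s := Finset.Ico (L.kp - 1) (L.kp - 1 + i)) fun m hm => by
      rw [if_neg (by rwa [Finset.mem_Ico] at hm), zero_mul]]
    rw [Finset.sum_congr rfl fun m hm => by
      rw [if_pos (Finset.mem_Ico.1 hm), one_mul], Finset.sum_Ico_eq_sum_range,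
      Nat.add_sub_cancel_left]
    have h5 := Finset.sum_range_sub (fun t : ℕ => f t) i
    simp only [Nat.cast_zero] at h5
    rw [← h5, zero_sub, neg_one_mul, ← sub_eq_add_neg]
    congr 1
    refine Finset.sum_congr rfl fun t _ => ?_
    rw [(by omega : ((L.kp - 1 + t : ℕ) : ℤ) + 2 - L.kp = (t + 1 : ℕ)),
      (by omega : ((t + 1 : ℕ) : ℤ) - 1 = t)]

theorem Omega_mulVec_inr (i : ℕ) (f : ℤ → ℂ) (v : Fin L.kp → ℂ) (x : ℂ)
    (hv : ∀ j, ∑ c, v c * R.colSeq c j = f j - f (j - 1)) :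
    (R.Omega i).mulVec (Sum.elim v fun _ => x) (Sum.inr ()) =
      ∑ l ∈ Finset.Icc 1 L.k, L.q l • ∑ t ∈ Finset.range l, f (t + 1)
        - ((∑ l ∈ Finset.Icc 1 L.k, (l : ℝ) * L.q l : ℝ) : ℂ) * f 0
        + ((∑ l ∈ Finset.Icc 1 L.k, L.p l - ∑ l ∈ Finset.Icc 1 L.k, (l : ℝ) * L.q l : ℝ) : ℂ)
          * x := by
  have h1 := R.sum_tsum_mul_Psi (fun m => L.eta m)
    (Finset.Ico (L.kp - 1) (L.kp - 1 + L.kq))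
    (fun m hm => by rw [L.eta_eq_zero m hm, Complex.ofReal_zero]) v
  have h2 := L.sum_Icc_kp fun _ => 1
  simp only [one_mul] at h2
  rw [Matrix.mulVec, dotProduct, Fintype.sum_sum_type]
  simp only [Omega, Matrix.fromBlocks_apply₂₁, Matrix.fromBlocks_apply₂₂, Matrix.of_apply,
    Sum.elim_inl, Sum.elim_inr, h1, hv, Finset.univ_unique, Finset.sum_singleton]
  rw [h2, L.sum_Icc_kq, ← tsum_eta_mul]
  congr 1
  refine tsum_congr fun m => ?_
  congr 3
  ring

/-! ### Cramer's rule -/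

/-- The index of the last row of the half-accordion matrices. -/
def lastRow (L : RandomLeap) : Fin L.kp :=
  ⟨L.kp - 1, by have := (Finset.mem_Icc.1 L.kp_mem.1).1; omega⟩

theorem Omega_apply_of_ne (i : ℕ) (b c : Fin L.kp ⊕ Unit) (hb : b ≠ Sum.inl (lastRow L)) :
    R.Omega i b c = R.Omega 0 b c := by
  rcases b with a | _
  · have ha := a.2
    have hne : (a : ℕ) ≠ L.kp - 1 := fun h => hb (congrArg Sum.inl (Fin.ext h))
    have h : L.halfAccordion i a = L.halfAccordion 0 a := by
      funext m
      simp only [halfAccordion, Matrix.of_apply]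
      have h1 : (a : ℕ) + 1 < L.kp := by omega
      rw [if_pos h1, if_pos h1]
    rcases c with c | _ <;> simp [Omega, h]
  · rcases c with c | _ <;> simp [Omega]

/-- The matrix `Ω_i` with its last half-accordion row replaced by a unit vector; it does not
depend on `i`. -/
def reducedOmega : Matrix (Fin L.kp ⊕ Unit) (Fin L.kp ⊕ Unit) ℂ :=
  (R.Omega 0).updateRow (Sum.inl (lastRow L)) (Pi.single (Sum.inr ()) 1)

theorem updateRow_Omega (i : ℕ) :
    (R.Omega i).updateRow (Sum.inl (lastRow L)) (Pi.single (Sum.inr ()) 1) = R.reducedOmega := by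
  ext b c
  rw [reducedOmega, Matrix.updateRow_apply, Matrix.updateRow_apply]
  split_ifs with h
  · rfl
  · exact R.Omega_apply_of_ne i b c h

/-- A kernel vector has `x = 0`, and its increments integrate to a decaying `f` that is constant on
the boundary. The `η` row and zero flow then give `drift * f 0 = 0`, so `f = 0` and `v = 0`. -/
theorem det_reducedOmega_ne_zero
    (hgcd : ((Finset.Icc 1 L.k).filter fun j => 0 < L.p j + L.q j).gcd id = 1)
    (hd : L.drift < 0) : R.reducedOmega.det ≠ 0 := by
  have hk := (Finset.mem_Icc.1 L.kp_mem.1).1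
  intro hdet
  obtain ⟨u, hu, hker⟩ := Matrix.exists_mulVec_eq_zero_iff.2 hdet
  obtain ⟨v, x, rfl⟩ : ∃ v x, u = Sum.elim v fun _ => x :=
    ⟨fun c => u (Sum.inl c), u (Sum.inr ()), by ext (_ | _) <;> rfl⟩
  have hx : x = 0 := by
    have := congrFun hker (Sum.inl (lastRow L))
    simpa [reducedOmega, Matrix.mulVec] using this
  subst hx
  have hrow (b) (hb : b ≠ Sum.inl (lastRow L)) :
      (R.Omega 0).mulVec (Sum.elim v fun _ => 0) b = 0 := by
    have := congrFun hker b
    simpa [reducedOmega, Matrix.mulVec, Matrix.updateRow_ne hb] using this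
  have hg : ∑ c, v c • R.colSeq c ∈ L.decaying :=
    L.decaying.sum_mem fun c _ => L.decaying.smul_mem _ (R.colSeq_mem_decaying hgcd hd c)
  obtain ⟨f, hf, hfg⟩ := L.exists_mem_decaying_sub hg
  have hv (j) : ∑ c, v c * R.colSeq c j = f j - f (j - 1) := by
    rw [hfg]
    simp
  have hconst : ∀ n : ℕ, n < L.kp → f (-n) = f 0 := by
    intro n
    induction n with
    | zero => intro _; rfl
    | succ n ih =>
      intro hn
      obtain ⟨a, ha⟩ : ∃ a : Fin L.kp, (a : ℕ) = L.kp - 2 - n := ⟨⟨L.kp - 2 - n, by omega⟩, rfl⟩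
      have h1 := hrow (Sum.inl a) fun h => by
        have := congrArg Fin.val (Sum.inl_injective h)
        simp only [lastRow] at this
        omega
      rw [R.Omega_mulVec_inl 0 f v 0 hv, if_pos (by omega), ite_self, add_zero, sub_eq_zero,
        (by omega : (a : ℤ) + 2 - L.kp = -n),
        (by omega : (a : ℤ) + 1 - L.kp = -((n + 1 : ℕ) : ℤ))] at h1
      rw [← h1, ih (by omega)]
  have hflux := L.flux_zero_eq_zero f (fun j _ => hf.1 j) hf.2.tendsto_atTop_zero
  have hp (l : ℕ) : L.p l • ∑ t ∈ Finset.range l, f (0 - t)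
      = ((l * L.p l : ℝ) : ℂ) * f 0 := by
    rcases le_or_gt l L.kp with h | h
    · rw [Finset.sum_congr rfl fun t ht => by
        rw [zero_sub, hconst t ((Finset.mem_range.1 ht).trans_le h)]]
      simp
      ring
    · simp [L.p_eq_zero_of_kp_lt h]
  have heta := hrow (Sum.inr ()) (by simp)
  rw [R.Omega_mulVec_inr 0 f v 0 hv, mul_zero, add_zero] at heta
  simp only [flux, Finset.sum_sub_distrib, hp, zero_add, add_comm (1 : ℤ)] at hflux
  rw [← Finset.sum_mul, ← Complex.ofReal_sum, sub_eq_zero] at hflux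
  rw [← hflux, ← sub_mul, ← Complex.ofReal_sub, ← drift_eq] at heta
  have hf0 : f 0 = 0 := by
    refine (mul_eq_zero.1 heta).resolve_left ?_
    exact_mod_cast hd.ne
  have hfz : f = 0 := L.eq_zero_of_mem_decaying hf fun i hi hi' => by
    have := hconst (-i).toNat (by omega)
    rwa [Int.toNat_of_nonneg (by omega), neg_neg, hf0] at this
  have hv0 : ∀ c, v c = 0 := Fintype.linearIndependent_iff.1 R.linearIndependent_colSeq v (by
    funext i
    rw [← hfg, hfz]
    simp)
  refine hu ?_
  ext (c | _)
  · exact hv0 c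
  · rfl

/-- Cramer's rule: the determinants `det Ω_i` are proportional to the solution `f` of the
stationarity equations. -/
theorem det_Omega
    (hgcd : ((Finset.Icc 1 L.k).filter fun j => 0 < L.p j + L.q j).gcd id = 1)
    (hd : L.drift < 0) {f : ℤ → ℂ} (hf : f ∈ L.decaying)
    (hb : ∀ i, 1 - (L.kp : ℤ) ≤ i → i < 0 → f i = 0) (hone : f 0 = 1) (i : ℕ) :
    (R.Omega i).det = -R.reducedOmega.det * f i := by
  have hk := (Finset.mem_Icc.1 L.kp_mem.1).1
  have hg : (fun i => f i - f (i - 1)) ∈ L.decaying :=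
    L.decaying.sub_mem hf (L.comp_sub_one_mem_decaying hf)
  obtain ⟨v, hv⟩ := R.exists_eq_sum_colSeq hgcd hd hg
  -- The entry `-1` cancels the jump of `f` from `-1` to `0` and the term `-f 0` in the last
  -- accordion row. In the `η` row it leaves minus the flow across the cut at `0`, which is zero.
  have hsol : (R.Omega i).mulVec (Sum.elim v fun _ => -1)
      = Pi.single (Sum.inl (lastRow L)) (f i) := by
    ext (a | _)
    · have ha := a.2
      rw [R.Omega_mulVec_inl i f v (-1) hv]
      split_ifs with h1 h2
      · rw [(by omega : (a : ℤ) + 2 - L.kp = 0), hone, hb _ (by omega) (by omega),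
          Pi.single_eq_of_ne]
        · ring
        · intro h
          have := congrArg Fin.val (Sum.inl_injective h)
          simp only [lastRow] at this
          omega
      · rw [hb _ (by omega) (by omega), hb _ (by omega) (by omega), Pi.single_eq_of_ne]
        · ring
        · intro h
          have := congrArg Fin.val (Sum.inl_injective h)
          simp only [lastRow] at this
          omega
      · have : a = lastRow L := Fin.ext (by simp only [lastRow]; omega)
        rw [this, Pi.single_eq_same, hone]
        ring
    · rw [R.Omega_mulVec_inr i f v (-1) hv, Pi.single_eq_of_ne (by simp), hone]
      have hflux := L.flux_zero_eq_zero f (fun j _ => hf.1 j) hf.2.tendsto_atTop_zero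
      have hp (l : ℕ) (hl : l ∈ Finset.Icc 1 L.k) :
          L.p l • ∑ t ∈ Finset.range l, f (0 - t) = (L.p l : ℂ) := by
        rcases le_or_gt l L.kp with h | h
        · rw [Finset.sum_eq_single_of_mem 0 (by have := Finset.mem_Icc.1 hl; simp; omega)]
          · simp [hone]
          · intro t ht hne
            have := Finset.mem_range.1 ht
            exact hb _ (by omega) (by omega)
        · simp [L.p_eq_zero_of_kp_lt h]
      rw [flux, Finset.sum_sub_distrib, Finset.sum_congr rfl hp, sub_eq_zero] at hflux
      simp only [zero_add, add_comm (1 : ℤ)] at hflux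
      rw [← hflux]
      push_cast
      ring
  -- The only adjugate entry that survives is the cofactor of the last accordion row and the last
  -- column, which is `det reducedOmega`.
  have hcr := congrFun (congrArg (R.Omega i).adjugate.mulVec hsol) (Sum.inr ())
  rw [Matrix.mulVec_mulVec, Matrix.adjugate_mul, Matrix.smul_mulVec, Matrix.one_mulVec,
    Matrix.mulVec_single] at hcr
  simp only [Pi.smul_apply, Sum.elim_inr, smul_eq_mul, Matrix.col_apply,
    Matrix.adjugate_apply, updateRow_Omega, MulOpposite.smul_eq_mul_unop,
    MulOpposite.unop_op] at hcr
  linear_combination -hcr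

end RootOrdering

end

end RandomLeap

/-! ### The theorem -/

theorem theorem10 (L : RandomLeap)
    (hgcd : ((Finset.Icc 1 L.k).filter fun j => 0 < L.p j + L.q j).gcd id = 1) :
    (0 ≤ L.drift → ¬ ∃ π : ℕ → ℝ, IsStationaryDistribution L.reflectTransition π) ∧
    (L.drift < 0 →
      ∃ π : ℕ → ℝ, IsStationaryDistribution L.reflectTransition π ∧
        (∀ π' : ℕ → ℝ, IsStationaryDistribution L.reflectTransition π' → π' = π) ∧
        ∀ R : L.RootOrdering,
          (∑ j ∈ Finset.univ.filter (fun j => ‖R.y j‖ < 1), R.mult j = L.kp) ∧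
          Summable (fun j : ℕ => (R.Omega j).det) ∧
          (∑' j : ℕ, (R.Omega j).det ≠ 0) ∧
          ∀ i : ℕ, (π i : ℂ) = (R.Omega i).det / ∑' j : ℕ, (R.Omega j).det) := by
  refine ⟨fun hd ⟨π, hπ⟩ => L.not_isStationary_of_drift_nonneg hd π hπ, fun hd => ?_⟩
  -- This ordering only serves to construct `f`; the determinant formula is then proved for an
  -- arbitrary one with the same `f`.
  obtain ⟨R₀⟩ := L.nonempty_rootOrdering
  obtain ⟨f, hf, hb, hone⟩ := R₀.exists_decaying_single hgcd hd
  have hk := (Finset.mem_Icc.1 L.kp_mem.1).1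
  -- The boundary data are real, so the imaginary part vanishes by uniqueness.
  have hreal (n : ℕ) : f n = ((f n).re : ℂ) := by
    refine Complex.ext (by simp) ?_
    rw [Complex.ofReal_im]
    refine L.eq_zero_of_boundary_eq_zero (fun i => (f i).im) (fun j _ => ?_) (fun i h h' => ?_)
      ((Complex.continuous_im.tendsto 0).comp hf.2.tendsto_atTop_zero) n (by omega)
    · rw [← hf.1 j]
      exact (L.map_step Complex.imLm f j).symm
    · rcases h'.lt_or_eq with h' | rfl
      · simp [hb i h h']
      · simp [hone]
  have hsum : Summable fun n : ℕ => (f n).re := hf.2.mapL Complex.reCLM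
  obtain ⟨hpos, hstat, huniq⟩ := L.isStationary_of_summable (fun i => (f i).re) (fun j _ => by
    rw [← hf.1 j]
    exact (L.map_step Complex.reLm f j).symm) (fun i h h' => by simp [hb i h h'])
    (by simp [hone]) hsum
  refine ⟨_, hstat, huniq, fun R => ?_⟩
  have hdet := R.det_Omega hgcd hd hf hb hone
  have hK := neg_ne_zero.2 (R.det_reducedOmega_ne_zero hgcd hd)
  have hts : ∑' j : ℕ, f j = ((∑' j : ℕ, (f j).re : ℝ) : ℂ) := by
    rw [Complex.ofReal_tsum]
    exact tsum_congr hreal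
  have hne : ∑' j : ℕ, f j ≠ 0 := by
    rw [hts]
    exact_mod_cast hpos.ne'
  refine ⟨R.sum_mult_norm_lt_one hgcd hd, ?_, ?_, fun i => ?_⟩
  · simpa only [hdet] using hf.2.mul_left _
  · simp only [hdet, tsum_mul_left]
    exact mul_ne_zero hK hne
  · simp only [hdet, tsum_mul_left]
    rw [mul_div_mul_left _ _ hK, hts, hreal i]
    push_cast
    simp
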